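/- Let $G$ be a finite group. A $G$-module is a $\mathbb Z[G]$-module, $\widehat H^n(G,-)$ denotes Tate cohomology for $n\in\mathbb Z$, and $\operatorname{Hom}_{\mathbb Z}(X,A)$ carries the conjugation action of $G$. For $G$-modules $X,X',A$, composition $\operatorname{Hom}_{\mathbb Z}(X,A)\times\operatorname{Hom}_{\mathbb Z}(X',X)\to\operatorname{Hom}_{\mathbb Z}(X',A)$, $(f,\varphi)\mapsto f\circ\varphi$, induces cup products $$\cup\colon\widehat H^p(G,\operatorname{Hom}_{\mathbb Z}(X,A))\times\widehat H^q(G,\operatorname{Hom}_{\mathbb Z}(X',X))\to\widehat H^{p+q}(G,\operatorname{Hom}_{\mathbb Z}(X',A))\qquad(p,q\in\mathbb Z).$$ In particular $R'=\widehat H^0(G,\operatorname{Hom}_{\mathbb Z}(X',X'))$ is a ring under $\cup$, and it acts by $\cup$ on the right on $\widehat H^n(G,\operatorname{Hom}_{\mathbb Z}(X',A))$ for all $A$ and $n$. For $r\in\mathbb Z$, a pair $(X,X')$ of $G$-modules is called an $r$-encoding pair if for some $i\in\mathbb Z$ there is a natural isomorphism of functors of $G$-modules $\widehat H^i(G,\operatorname{Hom}_{\mathbb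 Z}(X,-))\simeq\widehat H^{i+r}(G,\operatorname{Hom}_{\mathbb Z}(X',-))$. **Theorem.** Let $(X,X')$ be an $r$-encoding pair. Then for every $G$-module $A$ and every $i\in\mathbb Z$, the map $y\mapsto(x\mapsto y\cup x)$ is a well-defined isomorphism of abelian groups $$\widehat H^i(G,\operatorname{Hom}_{\mathbb Z}(X,A))\xrightarrow{\ \sim\ }\operatorname{Hom}_{R'}\bigl(\widehat H^r(G,\operatorname{Hom}_{\mathbb Z}(X',X)),\widehat H^{i+r}(G,\operatorname{Hom}_{\mathbb Z}(X',A))\bigr),$$ where $\operatorname{Hom}_{R'}$ denotes homomorphisms of right $R'$-modules. -/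

import Mathlib

open CategoryTheory

noncomputable section

/-!
Conventions. `k` is a commutative ring (below only `k = ℤ` is used) and `G` a finite group; a
`G`-module is an object of `Rep k G`, and `tateCohomology A n` is `Ĥⁿ(G, A)`.
We construct the cup product on Tate cohomology, in all integral degrees, by dimension shifting,
and then specialise it to the composition pairing between modules of homomorphisms.
-/

namespace TateCup

section

variable {k G : Type} [CommRing k] [Group G]

/-! ### The induced module `Fun(G, A)` and its vanishing Tate cohomology -/

/-- The diagonal action `(g f)(h) = g (f (g⁻¹ h))` on `Fun(G, A) ≅ k[G] ⊗ A`. -/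
def funRho (A : Rep.{0} k G) : Representation k G (G → A) where
  toFun g :=
    { toFun := fun f h => A.ρ g (f (g⁻¹ * h))
      map_add' := fun f₁ f₂ => by ext h; simp
      map_smul' := fun c f => by ext h; simp }
  map_one' := by ext f h; simp
  map_mul' g₁ g₂ := by
    refine LinearMap.ext fun f => funext fun h => ?_
    simp [mul_assoc]

/-- The induced `G`-module `Fun(G, A)`. -/
abbrev funRep (A : Rep.{0} k G) : Rep.{0} k G := Rep.of (funRho A)

lemma funRho_apply (A : Rep.{0} k G) (g : G) (f : G → A) (h : G) :
    funRho A g f h = A.ρ g (f (g⁻¹ * h)) := rfl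

/-- The embedding `A → Fun(G, A)` as constant functions. -/
def funConst (A : Rep.{0} k G) : A ⟶ funRep A :=
  Rep.ofHom (σ := funRho A) ⟨LinearMap.pi fun _ => LinearMap.id, fun g => by
    refine LinearMap.ext fun f => funext fun h => rfl⟩

/-- The surjection `Fun(G, A) → A`, `f ↦ ∑ h, f h`. -/
def funSum [Fintype G] (A : Rep.{0} k G) : funRep A ⟶ A :=
  Rep.ofHom (ρ := funRho A) ⟨∑ h, LinearMap.proj h, fun g => by
      refine LinearMap.ext fun f => ?_
      simp only [LinearMap.comp_apply, LinearMap.sum_apply, LinearMap.proj_apply, map_sum]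
      exact Fintype.sum_equiv (Equiv.mulLeft g⁻¹) _ _ fun h => rfl⟩

lemma funConst_apply (A : Rep.{0} k G) (a : A) (h : G) : (funConst A).hom a h = a := rfl

lemma funSum_apply [Fintype G] (A : Rep.{0} k G) (f : G → A) : (funSum A).hom f = ∑ h, f h := by
  change (∑ h, LinearMap.proj h : (G → A) →ₗ[k] A) f = _
  simp

/-- The cokernel `A⁺` of `A → Fun(G, A)`. -/
abbrev upMod (A : Rep.{0} k G) : Rep.{0} k G :=
  Rep.quotient (funRep A) (LinearMap.range (funConst A).hom.toLinearMap) fun g => by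
    rintro _ ⟨a, rfl⟩
    exact ⟨A.ρ g a, rfl⟩

/-- The projection `Fun(G, A) → A⁺`. -/
def upMk (A : Rep.{0} k G) : funRep A ⟶ upMod A := Rep.mkQ _ _ _

/-- The kernel `A⁻` of `Fun(G, A) → A`. -/
abbrev downMod [Fintype G] (A : Rep.{0} k G) : Rep.{0} k G :=
  Rep.subrepresentation (funRep A) (LinearMap.ker (funSum A).hom.toLinearMap) fun g f hf => by
    have h := Rep.hom_comm_apply (funSum A) g f
    have hf' : (funSum A).hom f = 0 := hf
    change (funSum A).hom ((funRep A).ρ g f) = 0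
    rw [h, hf', map_zero]

/-- The inclusion `A⁻ → Fun(G, A)`. -/
def downIncl [Fintype G] (A : Rep.{0} k G) : downMod A ⟶ funRep A :=
  Rep.subtype _ _ _

/-- The short exact sequence `0 → A → Fun(G, A) → A⁺ → 0`. -/
def upSeq (A : Rep.{0} k G) : ShortComplex (Rep.{0} k G) :=
  ShortComplex.mk (funConst A) (upMk A) (by
    refine Rep.hom_ext (Representation.IntertwiningMap.ext (LinearMap.ext fun a => ?_))
    exact (Submodule.Quotient.mk_eq_zero _).2 ⟨a, rfl⟩)

/-- The short exact sequence `0 → A⁻ → Fun(G, A) → A → 0`. -/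
def downSeq [Fintype G] (A : Rep.{0} k G) : ShortComplex (Rep.{0} k G) :=
  ShortComplex.mk (downIncl A) (funSum A) (by
    refine Rep.hom_ext (Representation.IntertwiningMap.ext (LinearMap.ext fun a => ?_))
    exact a.2)

lemma shortExact_of_elements (S : ShortComplex (Rep.{0} k G))
    (hf : Function.Injective S.f.hom) (hg : Function.Surjective S.g.hom)
    (h : ∀ x, S.g.hom x = 0 → ∃ y, S.f.hom y = x) : S.ShortExact := by
  have key : (S.map (forget₂ (Rep.{0} k G) (ModuleCat.{0} k))).ShortExact :=
    { exact := (ShortComplex.moduleCat_exact_iff _).2 h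
      mono_f := (ModuleCat.mono_iff_injective _).2 hf
      epi_g := (ModuleCat.epi_iff_surjective _).2 hg }
  have h₁ := key.exact
  rw [ShortComplex.exact_map_iff_of_faithful] at h₁
  exact
    { exact := h₁
      mono_f := (Rep.mono_iff_injective _).2 hf
      epi_g := (Rep.epi_iff_surjective _).2 hg }

lemma upSeq_shortExact (A : Rep.{0} k G) : (upSeq A).ShortExact :=
  shortExact_of_elements _ (fun _ _ h => congrFun h 1) (Submodule.mkQ_surjective _)
    fun _ hx => (Submodule.Quotient.mk_eq_zero _).1 hx

lemma downSeq_shortExact [Fintype G] (A : Rep.{0} k G) : (downSeq A).ShortExact := by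
  classical
  refine shortExact_of_elements _ Subtype.val_injective (fun a => ⟨Pi.single 1 a, ?_⟩)
    fun x hx => ⟨⟨x, hx⟩, rfl⟩
  refine (funSum_apply A (Pi.single 1 a)).trans ?_
  exact (Finset.sum_pi_single' (1 : G) (show A from a) Finset.univ).trans (if_pos (Finset.mem_univ _))


/-- `Fun(G, A)` is coinduced from the trivial subgroup. -/
def funRepIsoCoind (A : Rep.{0} k G) :
    funRep A ≅ Rep.coind (⊥ : Subgroup G).subtype (Rep.res (⊥ : Subgroup G).subtype A) :=
  Rep.mkIso <| .mk
    { toFun := fun f => ⟨fun h => A.ρ h (f h⁻¹), by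
        rintro ⟨g, hg⟩ h
        obtain rfl : g = 1 := hg
        simp⟩
      map_add' := fun f₁ f₂ => by ext h; simp
      map_smul' := fun c f => by ext h; simp
      invFun := fun f h => A.ρ h (f.1 h⁻¹)
      left_inv := fun f => by ext h; simp
      right_inv := fun f => by ext h; simp }
    fun g => by
      refine LinearMap.ext fun f => Subtype.ext (funext fun h => ?_)
      change A.ρ h (A.ρ g (f (g⁻¹ * h⁻¹))) = A.ρ (h * g) (f (h * g)⁻¹)
      simp

lemma isZero_of_exactness [Fintype G] (M : Rep.{0} k G) (i j l : ℤ) (hij : i + 1 = j)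
    (hjl : j + 1 = l)
    (h : ∀ x, (tateComplex M).d j l x = 0 → ∃ y, (tateComplex M).d i j y = x) :
    Limits.IsZero (tateCohomology M j) := by
  refine ((HomologicalComplex.exactAt_iff_isZero_homology _ _).1 ?_)
  rw [HomologicalComplex.exactAt_iff' _ i j l (by simp; omega) (by simp; omega)]
  exact (ShortComplex.moduleCat_exact_iff _).2 h

lemma tate_d_zero_one_iff [Fintype G] (M : Rep.{0} k G) (x : (tateComplex M).X 0) :
    (tateComplex M).d 0 1 x = 0 ↔
      ∀ g, M.ρ g ((groupCohomology.cochainsIso₀ M).hom x) =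
        (groupCohomology.cochainsIso₀ M).hom x := by
  have h := congr($(groupCohomology.comp_d₀₁_eq M) x)
  have hinj : Function.Injective (groupCohomology.cochainsIso₁ M).hom :=
    (ModuleCat.mono_iff_injective _).1 inferInstance
  have h0 : (tateComplex M).d 0 1 x = 0 ↔
      (groupCohomology.cochainsIso₁ M).hom ((tateComplex M).d 0 1 x) = 0 :=
    ⟨fun h => (congrArg _ h).trans (map_zero (groupCohomology.cochainsIso₁ M).hom.hom), fun h => hinj (h.trans (map_zero _).symm)⟩
  have h1 : (groupCohomology.d₀₁ M) ((groupCohomology.cochainsIso₀ M).hom x) =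
      (groupCohomology.cochainsIso₁ M).hom ((tateComplex M).d 0 1 x) := h
  rw [h0, ← h1]
  constructor
  · intro h g
    exact sub_eq_zero.1 (congrFun h g)
  · intro h
    funext g
    exact sub_eq_zero.2 (h g)

lemma tate_d_neg_one_zero [Fintype G] (M : Rep.{0} k G) (m : M) :
    (tateComplex M).d (-1) 0 ((groupHomology.chainsIso₀ M).inv m) =
      (groupCohomology.cochainsIso₀ M).inv (M.ρ.norm m) := by
  change (Rep.tateNorm M) ((groupHomology.chainsIso₀ M).inv m) = _
  simp [Rep.tateNorm]

lemma tate_d_neg_two [Fintype G] (M : Rep.{0} k G) (z : G →₀ M) :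
    (tateComplex M).d (-2) (-1) ((groupHomology.chainsIso₁ M).inv z) =
      (groupHomology.chainsIso₀ M).inv (groupHomology.d₁₀ M z) :=
  congr($(groupHomology.eq_d₁₀_comp_inv M) z)

lemma funRho_norm_apply [Fintype G] (A : Rep.{0} k G) (f : G → A) (h : G) :
    (funRep A).ρ.norm f h = ∑ g, A.ρ g (f (g⁻¹ * h)) := by
  simp only [Representation.norm, LinearMap.sum_apply]
  exact Finset.sum_apply _ _ _

lemma isZero_funRep_zero [Fintype G] (A : Rep.{0} k G) :
    Limits.IsZero (tateCohomology (funRep A) 0) := by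
  classical
  refine isZero_of_exactness _ (-1) 0 1 rfl rfl fun x hx => ?_
  rw [tate_d_zero_one_iff] at hx
  obtain ⟨f, rfl⟩ : ∃ f, x = (groupCohomology.cochainsIso₀ (funRep A)).inv f :=
    ⟨(groupCohomology.cochainsIso₀ (funRep A)).hom x,
      (Iso.hom_inv_id_apply (groupCohomology.cochainsIso₀ (funRep A)) x).symm⟩
  replace hx : ∀ g, funRho A g f = f := by simpa using hx
  refine ⟨(groupHomology.chainsIso₀ (funRep A)).inv (Pi.single 1 (f 1)), ?_⟩
  rw [tate_d_neg_one_zero]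
  congr 1
  funext h
  rw [funRho_norm_apply, Finset.sum_eq_single h]
  · have := congrFun (hx h) h
    rw [funRho_apply] at this
    simpa using this
  · intro g _ hg
    have : g⁻¹ * h ≠ 1 := fun e => hg (inv_mul_eq_one.1 e)
    simp [this]
  · simp

lemma isZero_funRep_neg_one [Fintype G] (A : Rep.{0} k G) :
    Limits.IsZero (tateCohomology (funRep A) (-1)) := by
  classical
  refine isZero_of_exactness _ (-2) (-1) 0 rfl rfl fun x hx => ?_
  obtain ⟨f, rfl⟩ : ∃ f, x = (groupHomology.chainsIso₀ (funRep A)).inv f :=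
    ⟨(groupHomology.chainsIso₀ (funRep A)).hom x,
      (Iso.hom_inv_id_apply (groupHomology.chainsIso₀ (funRep A)) x).symm⟩
  rw [tate_d_neg_one_zero] at hx
  have hinj : Function.Injective (groupCohomology.cochainsIso₀ (funRep A)).inv :=
    (ModuleCat.mono_iff_injective _).1 inferInstance
  have hN : (funRep A).ρ.norm f = 0 := hinj (hx.trans (map_zero _).symm)
  have hN1 : ∑ g, A.ρ g⁻¹ (f g) = 0 := by
    have := congrFun hN 1
    rw [funRho_norm_apply] at this
    refine Eq.trans ?_ this
    exact Fintype.sum_equiv (Equiv.inv G) _ _ fun g => by simp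
  let w : G → (G → A) := fun s => Pi.single 1 (A.ρ s⁻¹ (f s))
  have hw : ∑ s, w s = 0 := by
    funext h
    rw [Finset.sum_apply]
    by_cases hh : h = 1
    · subst hh
      simpa [w] using hN1
    · simp [w, hh]
  have hsw : ∑ s, funRho A s (w s) = f := by
    funext h
    rw [Finset.sum_apply, Finset.sum_eq_single h]
    · simp [funRho_apply, w]
    · intro g _ hg
      have : g⁻¹ * h ≠ 1 := fun e => hg (inv_mul_eq_one.1 e)
      simp [funRho_apply, w, this]
    · simp
  refine ⟨(groupHomology.chainsIso₁ (funRep A)).inv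
    (∑ s, (Finsupp.single s⁻¹ (w s) : G →₀ (funRep A))), ?_⟩
  rw [tate_d_neg_two]
  congr 1
  rw [map_sum]
  trans ∑ s, (funRho A s (w s) - w s)
  · refine Finset.sum_congr rfl fun s _ => ?_
    exact (groupHomology.d₁₀_single (funRep A) s⁻¹ (w s)).trans (by rw [inv_inv])
  · rw [Finset.sum_sub_distrib, hsw, hw, sub_zero]

/-- The Tate cohomology of `Fun(G, A)` vanishes in every degree. -/
lemma isZero_funRep [Fintype G] (A : Rep.{0} k G) (n : ℤ) :
    Limits.IsZero (tateCohomology (funRep A) n) := by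
  classical
  obtain (_ | n) | (_ | n) := n
  · exact isZero_funRep_zero A
  · refine Limits.IsZero.of_iso ?_ ((TateCohomology.isoGroupCohomology (n + 1)).app (funRep A))
    refine Limits.IsZero.of_iso ?_
      ((groupCohomology.functor k G (n + 1)).mapIso (funRepIsoCoind A))
    exact Limits.IsZero.of_iso
      (isZero_groupCohomology_succ_of_subsingleton _ n)
      (groupCohomology.coindIso _ (n + 1))
  · exact isZero_funRep_neg_one A
  · refine Limits.IsZero.of_iso ?_ ((TateCohomology.isoGroupHomology (Int.negSucc (n + 1)) (n + 1)
      (by simp [Int.negSucc_eq])).app (funRep A))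
    refine Limits.IsZero.of_iso ?_
      ((groupHomology.functor k G (n + 1)).mapIso (funRepIsoCoind A ≪≫ (Rep.indCoindIso _).symm))
    exact Limits.IsZero.of_iso
      (isZero_groupHomology_succ_of_subsingleton _ n)
      (groupHomology.indIso _ (Rep.res (⊥ : Subgroup G).subtype A) (n + 1))


/-! ### Dimension shifting -/

/-- The connecting isomorphism `Ĥⁱ(G, A⁺) ≅ Ĥⁱ⁺¹(G, A)`. -/
def δUp [Fintype G] (A : Rep.{0} k G) (i j : ℤ) (hij : i + 1 = j) :
    tateCohomology (upMod A) i ≃+ tateCohomology A j :=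
  ((TateCohomology.map_tateComplexFunctor_shortExact (upSeq_shortExact A)).δIso i j hij
    (isZero_funRep A i) (isZero_funRep A j)).toLinearEquiv.toAddEquiv

/-- The connecting isomorphism `Ĥⁱ(G, A) ≅ Ĥⁱ⁺¹(G, A⁻)`. -/
def δDown [Fintype G] (A : Rep.{0} k G) (i j : ℤ) (hij : i + 1 = j) :
    tateCohomology A i ≃+ tateCohomology (downMod A) j :=
  ((TateCohomology.map_tateComplexFunctor_shortExact (downSeq_shortExact A)).δIso i j hij
    (isZero_funRep A i) (isZero_funRep A j)).toLinearEquiv.toAddEquiv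

/-! ### Degree zero -/

/-- The inclusion of the invariants `A^G` into the degree zero Tate cochains. -/
def invIncl [Fintype G] (A : Rep.{0} k G) :
    ModuleCat.of k A.ρ.invariants ⟶ (tateComplex A).X 0 :=
  show ModuleCat.of k A.ρ.invariants ⟶ (groupCohomology.inhomogeneousCochains A).X 0 from
    ModuleCat.ofHom A.ρ.invariants.subtype ≫ (groupCohomology.cochainsIso₀ A).inv

lemma invIncl_d [Fintype G] (A : Rep.{0} k G) : invIncl A ≫ (tateComplex A).d 0 1 = 0 := by
  ext a
  refine (tate_d_zero_one_iff A (invIncl A a)).2 fun g => ?_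
  have h : (groupCohomology.cochainsIso₀ A).hom (invIncl A a) = (a : A) :=
    Iso.inv_hom_id_apply (groupCohomology.cochainsIso₀ A) (a : A)
  rw [h]
  exact a.2 g

/-- The canonical map `A^G → Ĥ⁰(G, A)`, `a ↦ [a]`. -/
def zeroClass [Fintype G] (A : Rep.{0} k G) : A.ρ.invariants →+ tateCohomology A 0 :=
  ((tateComplex A).liftCycles (invIncl A) 1 (by simp) (invIncl_d A) ≫
    (tateComplex A).homologyπ 0).hom.toAddMonoidHom

lemma zeroClass_surjective [Fintype G] (A : Rep.{0} k G) :
    Function.Surjective (zeroClass A) := by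
  intro x
  obtain ⟨z, rfl⟩ := (ModuleCat.epi_iff_surjective ((tateComplex A).homologyπ 0)).1 inferInstance x
  have hz : (tateComplex A).d 0 1 ((tateComplex A).iCycles 0 z) = 0 :=
    congr($((tateComplex A).iCycles_d 0 1) z)
  refine ⟨⟨(groupCohomology.cochainsIso₀ A).hom ((tateComplex A).iCycles 0 z),
    (tate_d_zero_one_iff A _).1 hz⟩, ?_⟩
  refine congrArg ((tateComplex A).homologyπ 0) ?_
  refine (ModuleCat.mono_iff_injective ((tateComplex A).iCycles 0)).1 inferInstance ?_
  refine (congr($((tateComplex A).liftCycles_i (invIncl A) 1 (by simp) (invIncl_d A)) _)).trans ?_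
  exact Iso.hom_inv_id_apply (groupCohomology.cochainsIso₀ A) _

lemma exists_norm_of_zeroClass_eq_zero [Fintype G] (A : Rep.{0} k G) (a : A.ρ.invariants)
    (ha : zeroClass A a = 0) : ∃ b : A, A.ρ.norm b = a := by
  have hex : (ShortComplex.mk ((tateComplex A).toCycles (-1) 0) ((tateComplex A).homologyπ 0)
      (by simp)).Exact :=
    ShortComplex.exact_of_g_is_cokernel _ ((tateComplex A).homologyIsCokernel (-1) 0 (by simp))
  obtain ⟨y, hy⟩ := (ShortComplex.moduleCat_exact_iff _).1 hex _ ha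
  have h1 := congrArg ((tateComplex A).iCycles 0) hy
  have h2 := (congr($((tateComplex A).toCycles_i (-1) 0) y)).symm.trans
    (h1.trans (congr($((tateComplex A).liftCycles_i (invIncl A) 1 (by simp) (invIncl_d A)) a)))
  refine ⟨(groupHomology.chainsIso₀ A).hom y, ?_⟩
  have h3 := tate_d_neg_one_zero A ((groupHomology.chainsIso₀ A).hom y)
  rw [show (groupHomology.chainsIso₀ A).inv ((groupHomology.chainsIso₀ A).hom y) = y from
    Iso.hom_inv_id_apply (groupHomology.chainsIso₀ A) y, h2] at h3
  exact ((ModuleCat.mono_iff_injective (groupCohomology.cochainsIso₀ A).inv).1 inferInstance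
    h3).symm

/-- Functoriality: the map `Ĥⁿ(G, A) → Ĥⁿ(G, B)` induced by a `G`-homomorphism. -/
def tateMap [Fintype G] {A B : Rep.{0} k G} (f : A ⟶ B) (n : ℤ) :
    tateCohomology A n →+ tateCohomology B n :=
  ((tateCohomologyFunctor n).map f).hom.toAddMonoidHom

instance [Fintype G] (n : ℤ) : (tateCohomologyFunctor (R := k) (G := G) n).Additive := by
  unfold tateCohomologyFunctor; infer_instance

lemma tateMap_add [Fintype G] {A B : Rep.{0} k G} (f g : A ⟶ B) (n : ℤ) :
    tateMap (f + g) n = tateMap f n + tateMap g n := by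
  ext x
  simp [tateMap, Functor.map_add]

lemma tateMap_zero [Fintype G] (A B : Rep.{0} k G) (n : ℤ) : tateMap (0 : A ⟶ B) n = 0 := by
  ext x
  simp [tateMap]

lemma tateMap_comp_apply [Fintype G] {A B C : Rep.{0} k G} (f : A ⟶ B) (g : B ⟶ C) (n : ℤ)
    (x : tateCohomology A n) : tateMap (f ≫ g) n x = tateMap g n (tateMap f n x) := by
  simp [tateMap]

lemma tateMap_id_apply [Fintype G] {A : Rep.{0} k G} (n : ℤ)
    (x : tateCohomology A n) : tateMap (𝟙 A) n x = x := by
  simp [tateMap]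

lemma tateMap_zeroClass [Fintype G] {A B : Rep.{0} k G} (f : A ⟶ B) (a : A.ρ.invariants) :
    tateMap f 0 (zeroClass A a) = zeroClass B ⟨f.hom a, fun g => by
      rw [← Rep.hom_comm_apply, a.2 g]⟩ := by
  have h0 : (invIncl A ≫ (tateComplex.map f).f 0) ≫ (tateComplex B).d 0 1 = 0 := by
    rw [Category.assoc, HomologicalComplex.Hom.comm, ← Category.assoc, invIncl_d,
      Limits.zero_comp]
  have h1 : ((tateComplex A).liftCycles (invIncl A) 1 (by simp) (invIncl_d A) ≫
      (tateComplex A).homologyπ 0) ≫ HomologicalComplex.homologyMap (tateComplex.map f) 0 =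
      (tateComplex B).liftCycles _ 1 (by simp) h0 ≫ (tateComplex B).homologyπ 0 := by
    rw [Category.assoc, HomologicalComplex.homologyπ_naturality, ← Category.assoc,
      HomologicalComplex.liftCycles_comp_cyclesMap]
  refine (congr($h1 a)).trans ?_
  refine congrArg ((tateComplex B).homologyπ 0) ?_
  refine (ModuleCat.mono_iff_injective ((tateComplex B).iCycles 0)).1 inferInstance ?_
  refine (congr($((tateComplex B).liftCycles_i _ 1 (by simp) h0) a)).trans
    (Eq.trans ?_ (congr($((tateComplex B).liftCycles_i (invIncl B) 1 (by simp) (invIncl_d B))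
      (⟨f.hom a, fun g => by rw [← Rep.hom_comm_apply, a.2 g]⟩ : B.ρ.invariants))).symm)
  rfl

/-! ### Pairings -/

/-- A `G`-equivariant bilinear pairing `A × B → C`. -/
structure Pairing (A B C : Rep.{0} k G) where
  toFun : A →ₗ[k] B →ₗ[k] C
  equivariant : ∀ g a b, toFun (A.ρ g a) (B.ρ g b) = C.ρ g (toFun a b)

namespace Pairing

variable {A B C : Rep.{0} k G}

/-- The induced bilinear map `Fun(G, A) × B → Fun(G, C)`, `(f, b) ↦ (h ↦ β (f h) b)`. -/
def funLin (β : Pairing A B C) : (G → A) →ₗ[k] B →ₗ[k] (G → C) :=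
  LinearMap.mk₂ k (fun f b h => β.toFun (f h) b)
    (fun _ _ _ => by ext; simp) (fun _ _ _ => by ext; simp)
    (fun _ _ _ => by ext; simp) (fun _ _ _ => by ext; simp)

lemma funLin_apply (β : Pairing A B C) (f : G → A) (b : B) (h : G) :
    β.funLin f b h = β.toFun (f h) b := rfl

lemma funLin_equivariant (β : Pairing A B C) (g : G) (f : G → A) (b : B) :
    β.funLin (funRho A g f) (B.ρ g b) = funRho C g (β.funLin f b) := by
  ext h
  exact β.equivariant g _ _

/-- The induced pairing `A⁺ × B → C⁺`. -/
def up (β : Pairing A B C) : Pairing (upMod A) B (upMod C) where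
  toFun := Submodule.liftQ _
    (β.funLin.compr₂ (upMk C).hom.toLinearMap) (by
      rintro _ ⟨a, rfl⟩
      refine LinearMap.ext fun b => (Submodule.Quotient.mk_eq_zero _).2 ⟨β.toFun a b, rfl⟩)
  equivariant g a b := by
    obtain ⟨f, rfl⟩ := Submodule.mkQ_surjective _ a
    exact congrArg (upMk C).hom (β.funLin_equivariant g f b)

/-- The induced pairing `A⁻ × B → C⁻`. -/
def down [Fintype G] (β : Pairing A B C) : Pairing (downMod A) B (downMod C) where
  toFun := LinearMap.mk₂ k (fun f b => ⟨β.funLin f.1 b, by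
      have hf : ∑ h, (show G → A from f.1) h = 0 := (funSum_apply A f.1).symm.trans f.2
      refine (funSum_apply C (β.funLin f.1 b)).trans ?_
      simp only [funLin_apply]
      rw [← LinearMap.sum_apply, ← map_sum]
      exact (congrArg (fun a => β.toFun a b) hf).trans (by simp)⟩)
    (fun _ _ _ => Subtype.ext (by simp)) (fun _ _ _ => Subtype.ext (by simp))
    (fun _ _ _ => Subtype.ext (by simp)) (fun _ _ _ => Subtype.ext (by simp))
  equivariant g a b := Subtype.ext (β.funLin_equivariant g a.1 b)

/-- For `a ∈ A^G`, the `G`-homomorphism `β(a, -) : B → C`. -/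
def left (β : Pairing A B C) (a : A.ρ.invariants) : B ⟶ C :=
  Rep.ofHom ⟨β.toFun a, fun g => LinearMap.ext fun b => by
    have := β.equivariant g a b
    rw [a.2 g] at this
    exact this⟩

/-- For `b ∈ B^G`, the `G`-homomorphism `β(-, b) : A → C`. -/
def right (β : Pairing A B C) (b : B.ρ.invariants) : A ⟶ C :=
  Rep.ofHom ⟨β.toFun.flip b, fun g => LinearMap.ext fun a => by
    have := β.equivariant g a b
    rw [b.2 g] at this
    exact this⟩

lemma tateMap_left_norm [Fintype G] (β : Pairing A B C) (a : A.ρ.invariants) (a' : A)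
    (ha : A.ρ.norm a' = a) (q : ℤ) : tateMap (β.left a) q = 0 := by
  let u : B ⟶ funRep C := Rep.ofHom (σ := funRho C)
    ⟨LinearMap.pi fun h => β.toFun (A.ρ h a'), fun g => LinearMap.ext fun b => funext fun h => by
      have := β.equivariant g (A.ρ (g⁻¹ * h) a') b
      rw [← Module.End.mul_apply, ← map_mul, mul_inv_cancel_left] at this
      exact this⟩
  have hu : β.left a = u ≫ funSum C := by
    refine Rep.hom_ext (Representation.IntertwiningMap.ext (LinearMap.ext fun b => ?_))
    refine Eq.trans ?_ (funSum_apply C (u.hom b)).symm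
    change β.toFun a b = ∑ h, β.toFun (A.ρ h a') b
    rw [← ha, Representation.norm]
    simp
  ext x
  rw [hu, tateMap_comp_apply]
  have : tateMap u q x = 0 := by
    have := (ModuleCat.isZero_iff_subsingleton).1 (isZero_funRep C q)
    exact Subsingleton.elim _ _
  rw [this, map_zero]; rfl

end Pairing

/-! ### The cup product -/

/-- Transport along an equality of degrees. -/
def tateCast [Fintype G] (A : Rep.{0} k G) {p q : ℤ} (h : p = q) :
    tateCohomology A p ≃+ tateCohomology A q :=
  h ▸ AddEquiv.refl _

section

variable [Fintype G] {B : Rep.{0} k G}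

/-- `a ↦ β(a, -)_*` as a homomorphism from `A^G`. -/
def leftHom {A C : Rep.{0} k G} (β : Pairing A B C) (q : ℤ) :
    A.ρ.invariants →+ tateCohomology B q →+ tateCohomology C q where
  toFun a := tateMap (β.left a) q
  map_zero' := by
    rw [← tateMap_zero]
    congr 1
    refine Rep.hom_ext (Representation.IntertwiningMap.ext (LinearMap.ext fun b => ?_))
    exact congr($(β.toFun.map_zero) b)
  map_add' a a' := by
    rw [← tateMap_add]
    congr 1
    refine Rep.hom_ext (Representation.IntertwiningMap.ext (LinearMap.ext fun b => ?_))
    exact congr($(β.toFun.map_add a a') b)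

lemma leftHom_ker {A C : Rep.{0} k G} (β : Pairing A B C) (q : ℤ) :
    (zeroClass A).ker ≤ (leftHom β q).ker := fun a ha => by
  obtain ⟨b, hb⟩ := exists_norm_of_zeroClass_eq_zero A a ha
  exact β.tateMap_left_norm a b hb q

lemma tateMap_δUp {A C : Rep.{0} k G} (f : A ⟶ C) (F : funRep A ⟶ funRep C)
    (f' : upMod A ⟶ upMod C) (h₁ : f ≫ funConst C = funConst A ≫ F)
    (h₂ : F ≫ upMk C = upMk A ≫ f') (i j : ℤ) (hij : i + 1 = j)
    (x : tateCohomology (upMod A) i) :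
    tateMap f j (δUp A i j hij x) = δUp C i j hij (tateMap f' i x) :=
  congr($(HomologicalComplex.HomologySequence.δ_naturality
    ((tateComplexFunctor k G).mapShortComplex.map
      (⟨f, F, f', h₁, h₂⟩ : upSeq A ⟶ upSeq C))
    (TateCohomology.map_tateComplexFunctor_shortExact (upSeq_shortExact A))
    (TateCohomology.map_tateComplexFunctor_shortExact (upSeq_shortExact C)) i j hij) x)

lemma tateMap_δDown {A C : Rep.{0} k G} (f : A ⟶ C) (F : funRep A ⟶ funRep C)
    (f' : downMod A ⟶ downMod C) (h₁ : f' ≫ downIncl C = downIncl A ≫ F)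
    (h₂ : F ≫ funSum C = funSum A ≫ f) (i j : ℤ) (hij : i + 1 = j)
    (x : tateCohomology A i) :
    tateMap f' j (δDown A i j hij x) = δDown C i j hij (tateMap f i x) :=
  congr($(HomologicalComplex.HomologySequence.δ_naturality
    ((tateComplexFunctor k G).mapShortComplex.map
      (⟨f', F, f, h₁, h₂⟩ : downSeq A ⟶ downSeq C))
    (TateCohomology.map_tateComplexFunctor_shortExact (downSeq_shortExact A))
    (TateCohomology.map_tateComplexFunctor_shortExact (downSeq_shortExact C)) i j hij) x)

/-- The cup product `Ĥ⁰(G, A) × Ĥ^q(G, B) → Ĥ^q(G, C)` induced by `β`: it is characterised by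
`[a] ∪ y = β(a, -)_* y` for `a ∈ A^G`. -/
def cupZero {A C : Rep.{0} k G} (β : Pairing A B C) (q : ℤ) :
    tateCohomology A 0 →+ tateCohomology B q →+ tateCohomology C q :=
  (zeroClass A).liftOfSurjective (zeroClass_surjective A) ⟨leftHom β q, leftHom_ker β q⟩

lemma cupZero_zeroClass {A C : Rep.{0} k G} (β : Pairing A B C) (q : ℤ) (a : A.ρ.invariants)
    (y : tateCohomology B q) : cupZero β q (zeroClass A a) y = tateMap (β.left a) q y :=
  congr($(AddMonoidHom.liftOfRightInverse_comp_apply (zeroClass A) _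
    (Function.rightInverse_surjInv (zeroClass_surjective A)) ⟨leftHom β q, leftHom_ker β q⟩ a) y)

/-- The cup product in degrees `(n, q)`, `n ≥ 0`, by dimension shifting in the first variable:
`δ x ∪ y = δ (x ∪ y)` for the connecting isomorphisms of `0 → A → Fun(G, A) → A⁺ → 0` and of
`0 → C → Fun(G, C) → C⁺ → 0`. -/
def cupNonneg : (n : ℕ) → {A C : Rep.{0} k G} → Pairing A B C → (q m : ℤ) → (n : ℤ) + q = m →
    (tateCohomology A (n : ℤ) →+ tateCohomology B q →+ tateCohomology C m)
  | 0, _, C, β, q, m, h =>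
      (AddMonoidHom.compHom (tateCast C (by simpa using h) : _ ≃+ _).toAddMonoidHom).comp
        (cupZero β q)
  | n + 1, A, C, β, q, m, h =>
      (AddMonoidHom.compHom (δUp C (m - 1) m (by ring)).toAddMonoidHom).comp
        ((cupNonneg n β.up q (m - 1) (by push_cast at h; omega)).comp
          (δUp A n (n + 1 : ℕ) (by push_cast; rfl)).symm.toAddMonoidHom)

/-- The cup product in degrees `(-n, q)`, `n ≥ 0`, by dimension shifting in the first variable:
`δ (x ∪ y) = δ x ∪ y` for the connecting isomorphisms of `0 → A⁻ → Fun(G, A) → A → 0` and of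
`0 → C⁻ → Fun(G, C) → C → 0`. -/
def cupNeg : (n : ℕ) → {A C : Rep.{0} k G} → Pairing A B C → (q m : ℤ) → -(n : ℤ) + q = m →
    (tateCohomology A (-(n : ℤ)) →+ tateCohomology B q →+ tateCohomology C m)
  | 0, _, C, β, q, m, h =>
      (AddMonoidHom.compHom (tateCast C (by simpa using h) : _ ≃+ _).toAddMonoidHom).comp
        (cupZero β q)
  | n + 1, A, C, β, q, m, h =>
      (AddMonoidHom.compHom (δDown C m (m + 1) rfl).symm.toAddMonoidHom).comp
        ((cupNeg n β.down q (m + 1) (by push_cast at h; omega)).comp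
          (δDown A (-(n + 1 : ℕ)) (-n) (by push_cast; ring)).toAddMonoidHom)

/-- The cup product `Ĥ^p(G, A) × Ĥ^q(G, B) → Ĥ^{p+q}(G, C)` of Tate cohomology, for all integers
`p` and `q`, induced by a `G`-equivariant bilinear pairing `β : A × B → C` (that is, the cup product
with values in `A ⊗ B` followed by the map induced by `A ⊗ B → C`). -/
def cup {A C : Rep.{0} k G} (β : Pairing A B C) (p q m : ℤ) (h : p + q = m) :
    tateCohomology A p →+ tateCohomology B q →+ tateCohomology C m :=
  match p, h with
  | Int.ofNat n, h => cupNonneg n β q m h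
  | Int.negSucc n, h => cupNeg (n + 1) β q m h

/-- For `b ∈ B^G`, the `G`-homomorphism `Fun(G, A) → Fun(G, C)` induced by `β(-, b)`. -/
def Pairing.funRight {A C : Rep.{0} k G} (β : Pairing A B C) (b : B.ρ.invariants) :
    funRep A ⟶ funRep C :=
  Rep.ofHom (ρ := funRho A) (σ := funRho C) ⟨β.funLin.flip b, fun g => LinearMap.ext fun f => by
    have := β.funLin_equivariant g f b
    rw [b.2 g] at this
    exact this⟩

lemma tateMap_right_δUp {A C : Rep.{0} k G} (β : Pairing A B C) (b : B.ρ.invariants) (i j : ℤ)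
    (hij : i + 1 = j) (x : tateCohomology (upMod A) i) :
    tateMap (β.right b) j (δUp A i j hij x) = δUp C i j hij (tateMap (β.up.right b) i x) :=
  tateMap_δUp _ (β.funRight b) _ rfl rfl i j hij x

lemma tateMap_right_δDown {A C : Rep.{0} k G} (β : Pairing A B C) (b : B.ρ.invariants) (i j : ℤ)
    (hij : i + 1 = j) (x : tateCohomology A i) :
    tateMap (β.down.right b) j (δDown A i j hij x) = δDown C i j hij (tateMap (β.right b) i x) := by
  refine tateMap_δDown _ (β.funRight b) _ rfl ?_ i j hij x
  refine Rep.hom_ext (Representation.IntertwiningMap.ext (LinearMap.ext fun f => ?_))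
  refine (funSum_apply C (β.funLin f b)).trans ?_
  change _ = β.toFun ((funSum A).hom f) b
  rw [funSum_apply, map_sum, LinearMap.sum_apply]
  rfl

lemma cupZero_right {A C : Rep.{0} k G} (β : Pairing A B C) (x : tateCohomology A 0)
    (b : B.ρ.invariants) : cupZero β 0 x (zeroClass B b) = tateMap (β.right b) 0 x := by
  obtain ⟨a, rfl⟩ := zeroClass_surjective A x
  rw [cupZero_zeroClass, tateMap_zeroClass, tateMap_zeroClass]
  rfl

lemma δUp_cast (C : Rep.{0} k G) {i i' j : ℤ} (e : i = i') (h : i + 1 = j) (h' : i' + 1 = j)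
    (x : tateCohomology (upMod C) i) : δUp C i' j h' (tateCast _ e x) = δUp C i j h x := by
  subst e; rfl

lemma δDown_cast (C : Rep.{0} k G) {i j j' : ℤ} (e : j = j') (h : i + 1 = j) (h' : i + 1 = j')
    (x : tateCohomology C i) : tateCast _ e (δDown C i j h x) = δDown C i j' h' x := by
  subst e; rfl

lemma cupNonneg_right (n : ℕ) : ∀ {A C : Rep.{0} k G} (β : Pairing A B C) (m : ℤ)
    (h : (n : ℤ) + 0 = m) (x : tateCohomology A (n : ℤ)) (b : B.ρ.invariants),
    cupNonneg n β 0 m h x (zeroClass B b) =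
      tateCast C (by simpa using h) (tateMap (β.right b) n x) := by
  induction n with
  | zero =>
    intro A C β m h x b
    exact congrArg (tateCast C _) (cupZero_right β x b)
  | succ n ih =>
    intro A C β m h x b
    obtain rfl : ((n + 1 : ℕ) : ℤ) = m := by simpa using h
    obtain ⟨x, rfl⟩ := (δUp A n (n + 1 : ℕ) (by push_cast; rfl)).surjective x
    change δUp C _ _ _ (cupNonneg n β.up 0 _ _ ((δUp A n (n + 1 : ℕ) _).symm
      (δUp A n (n + 1 : ℕ) _ x)) (zeroClass B b)) = _
    rw [AddEquiv.symm_apply_apply, ih, δUp_cast _ _ (by push_cast; rfl)]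
    exact (tateMap_right_δUp β b _ _ _ x).symm

lemma cupNeg_right (n : ℕ) : ∀ {A C : Rep.{0} k G} (β : Pairing A B C) (m : ℤ)
    (h : -(n : ℤ) + 0 = m) (x : tateCohomology A (-(n : ℤ))) (b : B.ρ.invariants),
    cupNeg n β 0 m h x (zeroClass B b) =
      tateCast C (by simpa using h) (tateMap (β.right b) (-(n : ℤ)) x) := by
  induction n with
  | zero =>
    intro A C β m h x b
    exact congrArg (tateCast C _) (cupZero_right β x b)
  | succ n ih =>
    intro A C β m h x b
    obtain rfl : -((n + 1 : ℕ) : ℤ) = m := by simpa using h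
    change (δDown C _ _ _).symm (cupNeg n β.down 0 _ _ (δDown A (-(n + 1 : ℕ)) (-n) _ x)
      (zeroClass B b)) = _
    rw [ih, AddEquiv.symm_apply_eq, tateMap_right_δDown]
    exact δDown_cast C (by push_cast; ring) _ _ _

/-- Cup product with a degree zero class on the right: `x ∪ [b] = β(-, b)_* x`. -/
lemma cup_right {A C : Rep.{0} k G} (β : Pairing A B C) (p : ℤ) (x : tateCohomology A p)
    (b : B.ρ.invariants) :
    cup β p 0 p (add_zero p) x (zeroClass B b) = tateMap (β.right b) p x := by
  obtain n | n := p
  · exact cupNonneg_right n β n (add_zero _) x b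
  · exact cupNeg_right (n + 1) β (-(n + 1 : ℕ)) (add_zero _) x b

end

/-! ### Cohomology of `Hom` modules -/

section

variable [Fintype G]

/-- The composition pairing `Hom(X, A) × Hom(X', X) → Hom(X', A)`, `(f, φ) ↦ f ∘ φ`. -/
def compPairing (X' X A : Rep.{0} k G) :
    Pairing ((Rep.ihom X).obj A) ((Rep.ihom X').obj X) ((Rep.ihom X').obj A) where
  toFun := LinearMap.llcomp k X' X A
  equivariant g f φ := by
    refine LinearMap.ext fun x => ?_
    have key (f : X →ₗ[k] A) (φ : X' →ₗ[k] X) : A.ρ g (f (X.ρ g⁻¹ (X.ρ g (φ (X'.ρ g⁻¹ x))))) =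
        A.ρ g (f (φ (X'.ρ g⁻¹ x))) := by simp
    exact key f φ

/-- The functor `Ĥⁿ(G, Hom(X, -))`. -/
abbrev homFunctor (n : ℤ) (X : Rep.{0} k G) : Rep.{0} k G ⥤ ModuleCat.{0} k :=
  Rep.ihom X ⋙ tateCohomologyFunctor n

/-- The abelian group `Ĥⁿ(G, Hom(X, A))`. -/
def TateHom (n : ℤ) (X A : Rep.{0} k G) : Type := (homFunctor n X).obj A

instance TateHom.instAddCommGroup (n : ℤ) (X A : Rep.{0} k G) : AddCommGroup (TateHom n X A) :=
  inferInstanceAs (AddCommGroup ((homFunctor n X).obj A))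

/-- The cup product `Ĥ^p(G, Hom(X, A)) × Ĥ^q(G, Hom(X', X)) → Ĥ^{p+q}(G, Hom(X', A))` induced by
composition. -/
def compCup {X' X A : Rep.{0} k G} (p q m : ℤ) (h : p + q = m) :
    TateHom p X A →+ TateHom q X' X →+ TateHom m X' A :=
  cup (compPairing X' X A) p q m h

/-- The class in `Ĥ⁰(G, Hom(X, A))` of a homomorphism of `G`-modules `X → A`. -/
def homClass (X A : Rep.{0} k G) :
    ((Rep.ihom X).obj A).ρ.invariants →+ TateHom 0 X A :=
  zeroClass ((Rep.ihom X).obj A)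

lemma homClass_surjective (X A : Rep.{0} k G) : Function.Surjective (homClass X A) :=
  zeroClass_surjective _

/-- The identity of `X`, as an invariant element of `Hom(X, X)`. -/
def idInv (X : Rep.{0} k G) : ((Rep.ihom X).obj X).ρ.invariants :=
  ⟨LinearMap.id, fun g => LinearMap.ext fun x => by
    change X.ρ g (X.ρ g⁻¹ x) = x
    simp⟩

/-- The class of the identity in `Ĥ⁰(G, Hom(X, X))`. -/
def idClass (X : Rep.{0} k G) : TateHom 0 X X := homClass X X (idInv X)

lemma compCup_homClass {X' X A : Rep.{0} k G} (p : ℤ) (x : TateHom p X A)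
    (φ : ((Rep.ihom X').obj X).ρ.invariants) :
    compCup p 0 p (add_zero p) x (homClass X' X φ) =
      tateMap ((compPairing X' X A).right φ) p x :=
  cup_right _ p x φ

lemma homClass_compCup {X' X A : Rep.{0} k G} (ψ : ((Rep.ihom X).obj A).ρ.invariants)
    (φ : ((Rep.ihom X').obj X).ρ.invariants) :
    compCup 0 0 0 (add_zero 0) (homClass X A ψ) (homClass X' X φ) =
      homClass X' A ⟨(compPairing X' X A).toFun ψ φ, fun g => by
        rw [← (compPairing X' X A).equivariant, ψ.2 g, φ.2 g]⟩ :=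
  (compCup_homClass 0 _ φ).trans (tateMap_zeroClass _ ψ)

lemma compCup_idClass {X A : Rep.{0} k G} (p : ℤ) (x : TateHom p X A) :
    compCup p 0 p (add_zero p) x (idClass X) = x := by
  have hr : (compPairing X X A).right (idInv X) = 𝟙 ((Rep.ihom X).obj A) :=
    Rep.hom_ext (Representation.IntertwiningMap.ext (LinearMap.ext fun f => LinearMap.comp_id f))
  rw [idClass, compCup_homClass, hr]
  exact tateMap_id_apply p x

lemma idClass_compCup {X' X : Rep.{0} k G} (x : TateHom 0 X' X) :
    compCup 0 0 0 (add_zero 0) (idClass X) x = x := by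
  obtain ⟨φ, rfl⟩ := homClass_surjective _ _ x
  exact (homClass_compCup _ φ).trans (congrArg _ (Subtype.ext (LinearMap.id_comp _)))

lemma compCup_assoc_zero {X₁ X₂ X₃ A : Rep.{0} k G} (p : ℤ) (x : TateHom p X₃ A)
    (y : TateHom 0 X₂ X₃) (z : TateHom 0 X₁ X₂) :
    compCup p 0 p (add_zero p) (compCup p 0 p (add_zero p) x y) z =
      compCup p 0 p (add_zero p) x (compCup 0 0 0 (add_zero 0) y z) := by
  obtain ⟨φ, rfl⟩ := homClass_surjective _ _ y
  obtain ⟨ψ, rfl⟩ := homClass_surjective _ _ z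
  rw [homClass_compCup, compCup_homClass, compCup_homClass, compCup_homClass]
  exact (tateMap_comp_apply _ _ _ _).symm

/-- The ring `Ĥ⁰(G, Hom(X, X))`; its multiplication is the cup product. -/
abbrev TateEnd (X : Rep.{0} k G) : Type := TateHom 0 X X

instance TateEnd.instRing (X : Rep.{0} k G) : Ring (TateEnd X) :=
  { TateHom.instAddCommGroup 0 X X with
    mul := fun x y => compCup 0 0 0 (add_zero 0) x y
    one := idClass X
    left_distrib := fun x y z => map_add (compCup 0 0 0 (add_zero 0) x) y z
    right_distrib := fun x y z => congr($(map_add (compCup 0 0 0 (add_zero 0)) x y) z)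
    zero_mul := fun x => congr($(map_zero (compCup 0 0 0 (add_zero 0))) x)
    mul_zero := fun x => map_zero (compCup 0 0 0 (add_zero 0) x)
    mul_assoc := fun x y z => compCup_assoc_zero 0 x y z
    one_mul := fun x => idClass_compCup x
    mul_one := fun x => compCup_idClass 0 x }

lemma TateEnd.mul_def {X : Rep.{0} k G} (x y : TateEnd X) :
    x * y = compCup 0 0 0 (add_zero 0) x y := rfl

/-- The right action of the ring `Ĥ⁰(G, Hom(X, X))` on `Ĥⁿ(G, Hom(X, A))` by the cup product (a right
module is a module over the opposite ring). -/
instance TateHom.instModule (n : ℤ) (X A : Rep.{0} k G) : Module (TateEnd X)ᵐᵒᵖ (TateHom n X A) where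
  smul ρ x := compCup n 0 n (add_zero n) x ρ.unop
  one_smul x := compCup_idClass n x
  mul_smul ρ σ x := (compCup_assoc_zero n x σ.unop ρ.unop).symm
  smul_zero ρ := congr($(map_zero (compCup n 0 n (add_zero n))) ρ.unop)
  smul_add ρ x y := congr($(map_add (compCup n 0 n (add_zero n)) x y) ρ.unop)
  add_smul ρ σ x := map_add (compCup n 0 n (add_zero n) x) ρ.unop σ.unop
  zero_smul x := map_zero (compCup n 0 n (add_zero n) x)

lemma TateHom.op_smul_def {n : ℤ} {X A : Rep.{0} k G} (ρ : TateEnd X) (x : TateHom n X A) :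
    MulOpposite.op ρ • x = compCup n 0 n (add_zero n) x ρ := rfl

/-- `(X, X')` is an `r`-encoding pair: for some integer `i` there is a natural isomorphism of functors
`Ĥⁱ(G, Hom(X, -)) ≅ Ĥ^{i+r}(G, Hom(X', -))`. -/
def IsEncodingPair (r : ℤ) (X X' : Rep.{0} k G) : Prop :=
  ∃ i : ℤ, Nonempty (homFunctor i X ≅ homFunctor (i + r) X')

end

end

end TateCup

end

open CategoryTheory

/-!
# Encoding pairs and `Hom` over the endomorphism ring of Tate cohomology

Think of `Ĥⁿ(G, Hom(X, A))` as the morphisms of degree `n` from `X` to `A` in a graded category whose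
composition is the cup product. In this language the functor `Ĥⁿ(G, Hom(X, -))` is corepresented by
a shift of `X`, and a natural isomorphism `Ĥⁱ(G, Hom(X, -)) ≅ Ĥ^{i+r}(G, Hom(X', -))` must come from
an invertible morphism `u : X' → X` of degree `r`. Once `u` has an inverse `v`, the element `u` is a
basis of the right `R'`-module `Ĥ^r(G, Hom(X', X))`, because `x = u ∪ (v ∪ x)` with `v ∪ x ∈ R'`;
so an `R'`-linear map `φ` is determined by `φ(u)`, and it is `x ↦ y ∪ x` for `y = φ(u) ∪ v`.

Two facts make this rigorous.

* The cup product is associative in all degrees (`cup_assoc`). Since it is defined by dimension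
  shifting in the first variable, associativity follows by the same dimension shifting, provided
  that `- ∪ y` commutes with the connecting isomorphisms of both `0 → A → Fun(G, A) → A⁺ → 0` and
  `0 → A⁻ → Fun(G, A) → A → 0` in every degree, whereas the definition uses the first in nonnegative
  and the second in negative degrees. `SplitPairing.cup_tateδ` shows more generally that `- ∪ y`
  commutes with the connecting homomorphism of any `k`-split sequence when the splittings respect the
  pairings: such a sequence receives a morphism from the second sequence for its last term, and has a
  morphism to the first sequence for its first term.
* The sequences above stay exact under `Hom(X, -)`, as they are `k`-split, and their middle terms
  remain induced. So the natural isomorphism may be moved to degree `0`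
  (`IsEncodingPair.nonempty_naturalEquiv`), where the Yoneda argument identifies it with `y ↦ y ∪ u`,
  `u` being the image of the identity (`NaturalEquiv.eq_compCup`); and the bijectivity of `y ↦ y ∪ u`
  spreads from degree `0` to all degrees (`compCup_bijective`). Surjectivity gives `v` with
  `v ∪ u = 1`, and injectivity gives `u ∪ v = 1` (`IsEncodingPair.exists_unit`).
-/

noncomputable section

namespace TateCup

section

variable {k G : Type} [CommRing k] [Group G]

lemma repHom_ext {A B : Rep.{0} k G} {f g : A ⟶ B} (h : ∀ a, f.hom a = g.hom a) : f = g :=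
  Rep.hom_ext (Representation.IntertwiningMap.ext (LinearMap.ext h))

/-! ### Naturality of the cup product -/

/-- The `G`-homomorphism `Fun(G, A) → Fun(G, C)` induced by `f : A ⟶ C`. -/
def funMap {A C : Rep.{0} k G} (f : A ⟶ C) : funRep A ⟶ funRep C :=
  Rep.ofHom (ρ := funRho A) (σ := funRho C)
    ⟨LinearMap.pi fun h => f.hom.toLinearMap ∘ₗ LinearMap.proj h, fun g =>
      LinearMap.ext fun _ => funext fun _ => Rep.hom_comm_apply f g _⟩

/-- The `G`-homomorphism `A⁺ → C⁺` induced by `f : A ⟶ C`. -/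
def upMap {A C : Rep.{0} k G} (f : A ⟶ C) : upMod A ⟶ upMod C :=
  Rep.ofHom ⟨Submodule.mapQ _ _ (funMap f).hom.toLinearMap (by
    rintro _ ⟨a, rfl⟩
    exact ⟨f.hom a, rfl⟩), fun g => by
      refine LinearMap.ext fun x => ?_
      obtain ⟨x, rfl⟩ := Submodule.mkQ_surjective _ x
      exact congrArg (upMk C).hom (Rep.hom_comm_apply (funMap f) g x)⟩

lemma funMap_comp_funSum [Fintype G] {A C : Rep.{0} k G} (f : A ⟶ C) :
    funMap f ≫ funSum C = funSum A ≫ f := by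
  refine repHom_ext fun x => ?_
  refine (funSum_apply C ((funMap f).hom x)).trans ?_
  change ∑ h, f.hom ((x : G → A) h) = f.hom ((funSum A).hom x)
  rw [funSum_apply, map_sum]

/-- The `G`-homomorphism `A⁻ → C⁻` induced by `f : A ⟶ C`. -/
def downMap [Fintype G] {A C : Rep.{0} k G} (f : A ⟶ C) : downMod A ⟶ downMod C :=
  Rep.ofHom ⟨((funMap f).hom.toLinearMap ∘ₗ Submodule.subtype _).codRestrict _ fun x => by
    have h : (funSum C).hom ((funMap f).hom x.1) = f.hom ((funSum A).hom x.1) :=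
      congr(($(funMap_comp_funSum f)).hom x.1)
    have hx : (funSum A).hom x.1 = 0 := x.2
    rw [hx, map_zero] at h
    exact h, fun g => LinearMap.ext fun x => Subtype.ext (Rep.hom_comm_apply (funMap f) g x.1)⟩

section

variable [Fintype G]

lemma tateMap_δUp_upMap {A C : Rep.{0} k G} (f : A ⟶ C) (i j : ℤ) (hij : i + 1 = j)
    (x : tateCohomology (upMod A) i) :
    tateMap f j (δUp A i j hij x) = δUp C i j hij (tateMap (upMap f) i x) :=
  tateMap_δUp f (funMap f) (upMap f) rfl rfl i j hij x

lemma tateMap_δDown_downMap {A C : Rep.{0} k G} (f : A ⟶ C) (i j : ℤ) (hij : i + 1 = j)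
    (x : tateCohomology A i) :
    tateMap (downMap f) j (δDown A i j hij x) = δDown C i j hij (tateMap f i x) :=
  tateMap_δDown f (funMap f) (downMap f) rfl (funMap_comp_funSum f) i j hij x

variable {B : Rep.{0} k G}

/-- `[a] ∪ y = β(a, -)_* y`. -/
lemma zeroClass_cup {A C : Rep.{0} k G} (β : Pairing A B C) (q : ℤ) (a : A.ρ.invariants)
    (y : tateCohomology B q) :
    cup β 0 q q (zero_add q) (zeroClass A a) y = tateMap (β.left a) q y :=
  cupZero_zeroClass β q a y

lemma cup_δUp_of_nonneg {A C : Rep.{0} k G} (β : Pairing A B C) {p p' q m m' : ℤ} (hp : 0 ≤ p)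
    (hpp : p + 1 = p') (hmm : m + 1 = m') (h : p + q = m) (h' : p' + q = m')
    (x : tateCohomology (upMod A) p) (y : tateCohomology B q) :
    cup β p' q m' h' (δUp A p p' hpp x) y = δUp C m m' hmm (cup β.up p q m h x y) := by
  obtain ⟨n, rfl⟩ := Int.eq_ofNat_of_zero_le hp
  obtain rfl : ((n + 1 : ℕ) : ℤ) = p' := by simpa using hpp
  obtain rfl : m = m' - 1 := by omega
  change δUp C _ _ _ (cupNonneg n β.up q _ _ ((δUp A n (n + 1 : ℕ) _).symm
      (δUp A n (n + 1 : ℕ) _ x)) y) = _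
  rw [AddEquiv.symm_apply_apply]
  rfl

lemma cup_δDown_of_neg {A C : Rep.{0} k G} (β : Pairing A B C) {p p' q m m' : ℤ} (hp : p < 0)
    (hpp : p + 1 = p') (hmm : m + 1 = m') (h : p + q = m) (h' : p' + q = m')
    (x : tateCohomology A p) (y : tateCohomology B q) :
    cup β.down p' q m' h' (δDown A p p' hpp x) y = δDown C m m' hmm (cup β p q m h x y) := by
  obtain ⟨n, rfl⟩ : ∃ n : ℕ, p = -(n + 1 : ℕ) := ⟨(-p - 1).toNat, by omega⟩
  obtain rfl : p' = -(n : ℤ) := by rw [← hpp]; push_cast; ring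
  subst hmm
  have key : cup β.down (-(n : ℤ)) q (m + 1) h' = cupNeg n β.down q (m + 1) h' := by
    cases n <;> rfl
  rw [key]
  exact (AddEquiv.apply_symm_apply (δDown C m (m + 1) rfl)
    (cupNeg n β.down q (m + 1) h' (δDown A _ _ hpp x) y)).symm

omit [Fintype G] in
lemma Pairing.up_upMap {A C A' C' : Rep.{0} k G} (β : Pairing A B C) (β' : Pairing A' B C')
    (f : A ⟶ A') (g : C ⟶ C') (b : B)
    (H : ∀ a, β'.toFun (f.hom a) b = g.hom (β.toFun a b)) (a : upMod A) :
    β'.up.toFun ((upMap f).hom a) b = (upMap g).hom (β.up.toFun a b) := by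
  obtain ⟨a, rfl⟩ := Submodule.mkQ_surjective _ a
  exact congrArg (upMk C').hom (funext fun h => H (a h))

lemma Pairing.down_downMap {A C A' C' : Rep.{0} k G} (β : Pairing A B C) (β' : Pairing A' B C')
    (f : A ⟶ A') (g : C ⟶ C') (b : B)
    (H : ∀ a, β'.toFun (f.hom a) b = g.hom (β.toFun a b)) (a : downMod A) :
    β'.down.toFun ((downMap f).hom a) b = (downMap g).hom (β.down.toFun a b) :=
  Subtype.ext (funext fun h => H (a.1 h))

/-- Naturality of the cup product in the first variable and the values, the second variable being
fixed. -/
lemma cup_tateMap {A C A' C' : Rep.{0} k G} (β : Pairing A B C) (β' : Pairing A' B C')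
    (f : A ⟶ A') (g : C ⟶ C') (H : ∀ a b, β'.toFun (f.hom a) b = g.hom (β.toFun a b))
    {p q m : ℤ} (h : p + q = m) (x : tateCohomology A p) (y : tateCohomology B q) :
    cup β' p q m h (tateMap f p x) y = tateMap g m (cup β p q m h x y) := by
  induction p using Int.induction_on generalizing A C A' C' m with
  | zero =>
    obtain rfl : q = m := by omega
    obtain ⟨a, rfl⟩ := zeroClass_surjective A x
    rw [tateMap_zeroClass, zeroClass_cup, zeroClass_cup, ← tateMap_comp_apply]
    congr 1
    exact congrArg (tateMap · _) (repHom_ext fun b => H a b)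
  | succ n ih =>
    obtain ⟨x, rfl⟩ := (δUp A n (n + 1) rfl).surjective x
    rw [tateMap_δUp_upMap, cup_δUp_of_nonneg β (by omega) rfl (by omega) (m := m - 1) (by omega),
      cup_δUp_of_nonneg β' (by omega) rfl (by omega) (m := m - 1) (by omega), tateMap_δUp_upMap,
      ih β.up β'.up _ _ (fun a b => Pairing.up_upMap β β' f g b (H · b) a)]
  | pred n ih =>
    apply (δDown C' m (m + 1) rfl).injective
    rw [← tateMap_δDown_downMap,
      ← cup_δDown_of_neg β (p' := -(n : ℤ)) (by omega) (by omega) rfl h (by omega),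
      ← cup_δDown_of_neg β' (p' := -(n : ℤ)) (by omega) (by omega) rfl h (by omega),
      ← tateMap_δDown_downMap,
      ih β.down β'.down _ _ (fun a b => Pairing.down_downMap β β' f g b (H · b) a)]

/-! ### The cup product and connecting homomorphisms -/

/-- The connecting homomorphism of a short exact sequence of `G`-modules. -/
def tateδ {S : ShortComplex (Rep.{0} k G)} (hS : S.ShortExact) (i j : ℤ) (hij : i + 1 = j) :
    tateCohomology S.X₃ i →+ tateCohomology S.X₁ j :=
  ((TateCohomology.map_tateComplexFunctor_shortExact hS).δ i j hij).hom.toAddMonoidHom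

lemma tateMap_tateδ {S T : ShortComplex (Rep.{0} k G)} (hS : S.ShortExact) (hT : T.ShortExact)
    (φ : S ⟶ T) (i j : ℤ) (hij : i + 1 = j) (x : tateCohomology S.X₃ i) :
    tateMap φ.τ₁ j (tateδ hS i j hij x) = tateδ hT i j hij (tateMap φ.τ₃ i x) :=
  congr($(HomologicalComplex.HomologySequence.δ_naturality
    ((tateComplexFunctor k G).mapShortComplex.map φ)
    (TateCohomology.map_tateComplexFunctor_shortExact hS)
    (TateCohomology.map_tateComplexFunctor_shortExact hT) i j hij) x)

end

section

/-! ### Split sequences -/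

/-- A `k`-linear (not necessarily equivariant) splitting of a sequence of `G`-modules: a section `s`
of `S.g` and a retraction `t` of `S.f` with `f t + s g = 1`. -/
structure LinearSplitting (S : ShortComplex (Rep.{0} k G)) where
  s : S.X₃ →ₗ[k] S.X₂
  t : S.X₂ →ₗ[k] S.X₁
  t_f : ∀ a, t (S.f.hom a) = a
  g_s : ∀ a, S.g.hom (s a) = a
  f_t : ∀ x, S.f.hom (t x) + s (S.g.hom x) = x

lemma LinearSplitting.shortExact {S : ShortComplex (Rep.{0} k G)} (σ : LinearSplitting S) :
    S.ShortExact :=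
  shortExact_of_elements S (Function.LeftInverse.injective σ.t_f)
    (Function.RightInverse.surjective σ.g_s) fun x hx => ⟨σ.t x, by
      have := σ.f_t x
      rwa [hx, map_zero, add_zero] at this⟩

/-- The `G`-homomorphism `N → Fun(G, M)`, `x ↦ (h ↦ h t (h⁻¹ x))`, attached to a `k`-linear map
`t : N → M`. -/
def toFunRep {M N : Rep.{0} k G} (t : N →ₗ[k] M) : N ⟶ funRep M :=
  Rep.ofHom (σ := funRho M) ⟨LinearMap.pi fun h => M.ρ h ∘ₗ t ∘ₗ N.ρ h⁻¹, fun g => by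
    refine LinearMap.ext fun x => funext fun h => ?_
    change M.ρ h (t (N.ρ h⁻¹ (N.ρ g x))) = M.ρ g (M.ρ (g⁻¹ * h) (t (N.ρ (g⁻¹ * h)⁻¹ x)))
    simp [mul_inv_rev]⟩

/-- The `G`-homomorphism `Fun(G, M) → N`, `F ↦ ∑ h, h s (h⁻¹ F(h))`, attached to a `k`-linear map
`s : M → N`. -/
def ofFunRep [Fintype G] {M N : Rep.{0} k G} (s : M →ₗ[k] N) : funRep M ⟶ N :=
  Rep.ofHom (ρ := funRho M)
    ⟨∑ h, N.ρ h ∘ₗ s ∘ₗ M.ρ h⁻¹ ∘ₗ LinearMap.proj h, fun g => by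
      refine LinearMap.ext fun F => ?_
      simp only [LinearMap.comp_apply, LinearMap.sum_apply, LinearMap.proj_apply, map_sum]
      refine Fintype.sum_equiv (Equiv.mulLeft g⁻¹) _ _ fun h => ?_
      change N.ρ h (s (M.ρ h⁻¹ (M.ρ g (F (g⁻¹ * h))))) =
        N.ρ g (N.ρ (g⁻¹ * h) (s (M.ρ (g⁻¹ * h)⁻¹ (F (g⁻¹ * h)))))
      simp [mul_inv_rev]⟩

lemma ofFunRep_apply [Fintype G] {M N : Rep.{0} k G} (s : M →ₗ[k] N) (F : G → M) :
    (ofFunRep s).hom F = ∑ h, N.ρ h (s (M.ρ h⁻¹ (F h))) := by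
  change (∑ h, N.ρ h ∘ₗ s ∘ₗ M.ρ h⁻¹ ∘ₗ LinearMap.proj h : (G → M) →ₗ[k] N) F = _
  simp

namespace LinearSplitting

variable {S : ShortComplex (Rep.{0} k G)} (σ : LinearSplitting S)

lemma upMk_toFunRep_f (a : S.X₁) : (upMk S.X₁).hom ((toFunRep σ.t).hom (S.f.hom a)) = 0 := by
  refine (Submodule.Quotient.mk_eq_zero _).2 ⟨a, funext fun h => ?_⟩
  change a = S.X₁.ρ h (σ.t (S.X₂.ρ h⁻¹ (S.f.hom a)))
  rw [← Rep.hom_comm_apply, σ.t_f]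
  simp

lemma upMk_toFunRep_s_g (x : S.X₂) : (upMk S.X₁).hom ((toFunRep σ.t).hom (σ.s (S.g.hom x))) =
    (upMk S.X₁).hom ((toFunRep σ.t).hom x) := by
  conv_rhs => rw [← σ.f_t x]
  rw [map_add, map_add, upMk_toFunRep_f, zero_add]

/-- The morphism from a split sequence to `0 → X₁ → Fun(G, X₁) → X₁⁺ → 0` which is the identity
on `X₁`. -/
def toUpSeq : S ⟶ upSeq S.X₁ where
  τ₁ := 𝟙 _
  τ₂ := toFunRep σ.t
  τ₃ := Rep.ofHom ⟨(upMk S.X₁).hom.toLinearMap ∘ₗ (toFunRep σ.t).hom.toLinearMap ∘ₗ σ.s, fun g => by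
    refine LinearMap.ext fun a => ?_
    obtain ⟨x, rfl⟩ := Function.RightInverse.surjective σ.g_s a
    change (upMk S.X₁).hom ((toFunRep σ.t).hom (σ.s (S.X₃.ρ g (S.g.hom x)))) =
      (upMod S.X₁).ρ g ((upMk S.X₁).hom ((toFunRep σ.t).hom (σ.s (S.g.hom x))))
    rw [← Rep.hom_comm_apply, upMk_toFunRep_s_g, upMk_toFunRep_s_g, Rep.hom_comm_apply,
      Rep.hom_comm_apply]⟩
  comm₁₂ := repHom_ext fun a => funext fun h => by
    change a = S.X₁.ρ h (σ.t (S.X₂.ρ h⁻¹ (S.f.hom a)))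
    rw [← Rep.hom_comm_apply, σ.t_f]
    simp
  comm₂₃ := repHom_ext fun x => (σ.upMk_toFunRep_s_g x).symm

/-- The comparison map `X₃ → X₁⁺` for a split sequence. -/
def toUp : S.X₃ ⟶ upMod S.X₁ := σ.toUpSeq.τ₃

variable [Fintype G]

lemma g_ofFunRep (F : G → S.X₃) : S.g.hom ((ofFunRep σ.s).hom F) = (funSum S.X₃).hom F := by
  rw [ofFunRep_apply, funSum_apply, map_sum]
  refine Finset.sum_congr rfl fun h _ => ?_
  rw [Rep.hom_comm_apply, σ.g_s]
  simp

lemma f_t_ofFunRep (F : downMod S.X₃) : S.f.hom (σ.t ((ofFunRep σ.s).hom F.1)) =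
    (ofFunRep σ.s).hom F.1 := by
  have h := σ.f_t ((ofFunRep σ.s).hom F.1)
  have h0 : S.g.hom ((ofFunRep σ.s).hom F.1) = 0 := (σ.g_ofFunRep F.1).trans F.2
  rwa [h0, map_zero, add_zero] at h

/-- The morphism from `0 → X₃⁻ → Fun(G, X₃) → X₃ → 0` to a split sequence which is the identity
on `X₃`. -/
def ofDownSeq : downSeq S.X₃ ⟶ S where
  τ₁ := Rep.ofHom ⟨σ.t ∘ₗ (ofFunRep σ.s).hom.toLinearMap ∘ₗ Submodule.subtype _, fun g => by
    refine LinearMap.ext fun F => Function.LeftInverse.injective σ.t_f ?_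
    refine (σ.f_t_ofFunRep ((downMod S.X₃).ρ g F)).trans ?_
    refine Eq.trans ?_ (Rep.hom_comm_apply S.f g _).symm
    refine Eq.trans ?_ (congrArg (S.X₂.ρ g) (σ.f_t_ofFunRep F)).symm
    exact Rep.hom_comm_apply (ofFunRep σ.s) g F.1⟩
  τ₂ := ofFunRep σ.s
  τ₃ := 𝟙 _
  comm₁₂ := repHom_ext fun F => σ.f_t_ofFunRep F
  comm₂₃ := repHom_ext fun F => σ.g_ofFunRep F

/-- The comparison map `X₃⁻ → X₁` for a split sequence. -/
def fromDown : downMod S.X₃ ⟶ S.X₁ := σ.ofDownSeq.τ₁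

lemma tateδ_eq_fromDown (i j : ℤ) (hij : i + 1 = j) (x : tateCohomology S.X₃ i) :
    tateδ σ.shortExact i j hij x = tateMap σ.fromDown j (δDown S.X₃ i j hij x) := by
  refine Eq.trans ?_ (tateMap_tateδ (downSeq_shortExact S.X₃) σ.shortExact σ.ofDownSeq i j hij x).symm
  exact congrArg _ (tateMap_id_apply i x).symm

lemma tateδ_eq_toUp (i j : ℤ) (hij : i + 1 = j) (x : tateCohomology S.X₃ i) :
    tateδ σ.shortExact i j hij x = δUp S.X₁ i j hij (tateMap σ.toUp i x) := by
  refine Eq.trans ?_ (tateMap_tateδ σ.shortExact (upSeq_shortExact S.X₁) σ.toUpSeq i j hij x)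
  exact (tateMap_id_apply j _).symm

end LinearSplitting

/-- Pairings of the terms of a split sequence with `B`, with values in the terms of another split
sequence, compatible with the maps of the sequences and with the splittings. -/
structure SplitPairing {S T : ShortComplex (Rep.{0} k G)} (σ : LinearSplitting S)
    (τ : LinearSplitting T) (B : Rep.{0} k G) where
  β₁ : Pairing S.X₁ B T.X₁
  β₂ : Pairing S.X₂ B T.X₂
  β₃ : Pairing S.X₃ B T.X₃
  map_f : ∀ a b, β₂.toFun (S.f.hom a) b = T.f.hom (β₁.toFun a b)
  map_g : ∀ x b, β₃.toFun (S.g.hom x) b = T.g.hom (β₂.toFun x b)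
  map_s : ∀ a b, β₂.toFun (σ.s a) b = τ.s (β₃.toFun a b)

namespace SplitPairing

variable {S T : ShortComplex (Rep.{0} k G)} {σ : LinearSplitting S} {τ : LinearSplitting T}
  {B : Rep.{0} k G} (β : SplitPairing σ τ B)

/-- Since `T.f` is injective, compatibility with the retractions follows from compatibility with the
sections. -/
lemma map_t (x : S.X₂) (b : B) : β.β₁.toFun (σ.t x) b = τ.t (β.β₂.toFun x b) := by
  apply Function.LeftInverse.injective τ.t_f
  have h1 := congr(β.β₂.toFun $(σ.f_t x) b)
  rw [map_add, LinearMap.add_apply, β.map_f, β.map_s, β.map_g] at h1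
  exact add_right_cancel (h1.trans (τ.f_t _).symm)

lemma map_toUp (a : S.X₃) (b : B) :
    β.β₁.up.toFun (σ.toUp.hom a) b = τ.toUp.hom (β.β₃.toFun a b) := by
  refine congrArg (upMk T.X₁).hom (funext fun h => ?_)
  change β.β₁.toFun (S.X₁.ρ h (σ.t (S.X₂.ρ h⁻¹ (σ.s a)))) b =
    T.X₁.ρ h (τ.t (T.X₂.ρ h⁻¹ (τ.s (β.β₃.toFun a b))))
  have hb : b = B.ρ h (B.ρ h⁻¹ b) := by simp
  rw [← β.map_s]
  conv_lhs => rw [hb]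
  rw [β.β₁.equivariant, β.map_t, β.β₂.equivariant]

variable [Fintype G]

lemma map_fromDown (F : downMod S.X₃) (b : B) :
    β.β₁.toFun (σ.fromDown.hom F) b = τ.fromDown.hom (β.β₃.down.toFun F b) := by
  refine (β.map_t ((ofFunRep σ.s).hom F.1) b).trans (congrArg τ.t ?_)
  refine Eq.trans ?_ (ofFunRep_apply τ.s (β.β₃.funLin F.1 b)).symm
  refine (congr(β.β₂.toFun $(ofFunRep_apply σ.s F.1) b)).trans ?_
  rw [map_sum, LinearMap.sum_apply]
  refine Finset.sum_congr rfl fun h _ => ?_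
  have hb : b = B.ρ h (B.ρ h⁻¹ b) := by simp
  rw [Pairing.funLin_apply, ← β.β₃.equivariant, ← β.map_s, ← β.β₂.equivariant, ← hb]

/-- Cup product with a class on the right commutes with connecting homomorphisms. In nonnegative
degrees the sequences are compared with the sequence `0 → A → Fun(G, A) → A⁺ → 0` of their first
terms, in negative degrees with the sequence `0 → A⁻ → Fun(G, A) → A → 0` of their last terms. -/
lemma cup_tateδ {p p' q m m' : ℤ} (hpp : p + 1 = p') (hmm : m + 1 = m') (h : p + q = m)
    (h' : p' + q = m') (x : tateCohomology S.X₃ p) (y : tateCohomology B q) :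
    cup β.β₁ p' q m' h' (tateδ σ.shortExact p p' hpp x) y =
      tateδ τ.shortExact m m' hmm (cup β.β₃ p q m h x y) := by
  obtain hp | hp := le_or_gt 0 p
  · rw [σ.tateδ_eq_toUp, τ.tateδ_eq_toUp, cup_δUp_of_nonneg β.β₁ hp hpp hmm h h',
      cup_tateMap β.β₃ β.β₁.up _ _ β.map_toUp]
  · rw [σ.tateδ_eq_fromDown, τ.tateδ_eq_fromDown,
      cup_tateMap β.β₃.down β.β₁ _ _ β.map_fromDown, cup_δDown_of_neg β.β₃ hp hpp hmm h h']

end SplitPairing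

/-! ### Associativity -/

/-- The `k`-linear section `[x] ↦ x - x(1)` of `Fun(G, A) → A⁺`. -/
def upSection (A : Rep.{0} k G) : upMod A →ₗ[k] funRep A :=
  Submodule.liftQ _
    (LinearMap.id - (funConst A).hom.toLinearMap ∘ₗ LinearMap.proj 1 : (G → A) →ₗ[k] (G → A)) (by
      rintro _ ⟨a, rfl⟩
      exact sub_self _)

/-- The splitting of `0 → A → Fun(G, A) → A⁺ → 0` given by evaluation at `1`. -/
def upSplitting (A : Rep.{0} k G) : LinearSplitting (upSeq A) where
  s := upSection A
  t := (LinearMap.proj 1 : (G → A) →ₗ[k] A)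
  t_f _ := rfl
  g_s a := by
    obtain ⟨x, rfl⟩ := Submodule.mkQ_surjective _ a
    exact (Submodule.Quotient.eq _).2 ⟨-(x : G → A) 1, funext fun h => by
      change -(x : G → A) 1 = ((x : G → A) h - (x : G → A) 1) - (x : G → A) h
      abel⟩
  f_t x := funext fun h => add_sub_cancel ((x : G → A) 1) ((x : G → A) h)

/-- The pairings of the terms of `0 → A → Fun(G, A) → A⁺ → 0` with `B`. -/
def Pairing.upSplit {A B C : Rep.{0} k G} (β : Pairing A B C) :
    SplitPairing (upSplitting A) (upSplitting C) B where
  β₁ := β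
  β₂ := ⟨β.funLin, β.funLin_equivariant⟩
  β₃ := β.up
  map_f _ _ := rfl
  map_g _ _ := rfl
  map_s a b := by
    obtain ⟨x, rfl⟩ := Submodule.mkQ_surjective _ a
    exact funext fun h => by
      change β.toFun ((x : G → A) h - (x : G → A) 1) b = β.toFun ((x : G → A) h) b -
        β.toFun ((x : G → A) 1) b
      rw [map_sub, LinearMap.sub_apply]

variable [Fintype G]

/-- `δ x ∪ y = δ (x ∪ y)` in every degree; for `p ≥ 0` this is the definition of the cup product. -/
lemma cup_δUp {A B C : Rep.{0} k G} (β : Pairing A B C) {p p' q m m' : ℤ}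
    (hpp : p + 1 = p') (hmm : m + 1 = m') (h : p + q = m) (h' : p' + q = m')
    (x : tateCohomology (upMod A) p) (y : tateCohomology B q) :
    cup β p' q m' h' (δUp A p p' hpp x) y = δUp C m m' hmm (cup β.up p q m h x y) :=
  β.upSplit.cup_tateδ hpp hmm h h' x y

lemma funSum_single [DecidableEq G] (A : Rep.{0} k G) (a : A) :
    (funSum A).hom (Pi.single 1 a : G → A) = a :=
  (funSum_apply A (Pi.single 1 a)).trans (by simp)

lemma Pairing.funSum_funLin {A B C : Rep.{0} k G} (β : Pairing A B C) (x : G → A) (b : B) :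
    (funSum C).hom (β.funLin x b) = β.toFun ((funSum A).hom x) b := by
  rw [funSum_apply, funSum_apply, map_sum, LinearMap.sum_apply]
  rfl

omit [Fintype G] in
lemma Pairing.funLin_single [DecidableEq G] {A B C : Rep.{0} k G} (β : Pairing A B C) (a : A)
    (b : B) : β.funLin (Pi.single 1 a) b = Pi.single 1 (β.toFun a b) := by
  funext h
  rw [Pairing.funLin_apply]
  by_cases hh : h = 1
  · subst hh; simp
  · simp [hh]

open scoped Classical in
/-- The splitting of `0 → A⁻ → Fun(G, A) → A → 0` given by the functions supported at `1`. -/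
def downSplitting (A : Rep.{0} k G) : LinearSplitting (downSeq A) where
  s := LinearMap.single k (fun _ : G => A) 1
  t := (LinearMap.id -
    (LinearMap.single k (fun _ : G => A) 1 ∘ₗ (funSum A).hom.toLinearMap)).codRestrict _ fun x => by
      change (funSum A).hom ((x : G → A) - Pi.single 1 ((funSum A).hom x)) = 0
      refine (funSum_apply A _).trans ?_
      have h : ∑ h, (x : G → A) h = (funSum A).hom x := (funSum_apply A x).symm
      simp [h]
  t_f F := Subtype.ext (by
    have hF : (funSum A).hom F.1 = 0 := F.2
    change (F.1 : G → A) - Pi.single 1 ((funSum A).hom F.1) = F.1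
    rw [hF]
    simp)
  g_s a := funSum_single A a
  f_t x := sub_add_cancel (x : G → A) _

open scoped Classical in
/-- The pairings of the terms of `0 → A⁻ → Fun(G, A) → A → 0` with `B`. -/
def Pairing.downSplit {A B C : Rep.{0} k G} (β : Pairing A B C) :
    SplitPairing (downSplitting A) (downSplitting C) B where
  β₁ := β.down
  β₂ := ⟨β.funLin, β.funLin_equivariant⟩
  β₃ := β
  map_f _ _ := rfl
  map_g x b := (β.funSum_funLin x b).symm
  map_s a b := β.funLin_single a b

/-- `δ x ∪ y = δ (x ∪ y)` in every degree; for `p < 0` this is the definition of the cup product. -/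
lemma cup_δDown {A B C : Rep.{0} k G} (β : Pairing A B C) {p p' q m m' : ℤ}
    (hpp : p + 1 = p') (hmm : m + 1 = m') (h : p + q = m) (h' : p' + q = m')
    (x : tateCohomology A p) (y : tateCohomology B q) :
    cup β.down p' q m' h' (δDown A p p' hpp x) y = δDown C m m' hmm (cup β p q m h x y) :=
  β.downSplit.cup_tateδ hpp hmm h h' x y

/-- Associativity of the cup product, for four pairings related by `γ(β(a, b), c) = γ'(a, β'(b, c))`.
In degree zero it is naturality of the cup product with `c`, and the general case follows by
dimension shifting in `a`. -/
lemma cup_assoc {A B C D E F : Rep.{0} k G} (β : Pairing A B D) (γ : Pairing D C E)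
    (β' : Pairing B C F) (γ' : Pairing A F E)
    (H : ∀ a b c, γ.toFun (β.toFun a b) c = γ'.toFun a (β'.toFun b c))
    {p q r m n l : ℤ} (hm : p + q = m) (hn : q + r = n) (hl : m + r = l) (hl' : p + n = l)
    (x : tateCohomology A p) (y : tateCohomology B q) (z : tateCohomology C r) :
    cup γ m r l hl (cup β p q m hm x y) z = cup γ' p n l hl' x (cup β' q r n hn y z) := by
  induction p using Int.induction_on generalizing A D E m l with
  | zero =>
    obtain rfl : q = m := by omega
    obtain rfl : n = l := by omega
    obtain ⟨a, rfl⟩ := zeroClass_surjective A x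
    rw [zeroClass_cup, zeroClass_cup]
    exact cup_tateMap β' γ (β.left a) (γ'.left a) (fun b c => H a b c) hn y z
  | succ i ih =>
    obtain ⟨x, rfl⟩ := (δUp A i (i + 1) rfl).surjective x
    rw [cup_δUp β rfl (by omega) (m := m - 1) (by omega),
      cup_δUp γ (by omega) (by omega) (m := l - 1) (by omega),
      cup_δUp γ' rfl (by omega) (m := l - 1) (by omega),
      ih β.up γ.up γ'.up (fun a b c => ?_) (by omega) (by omega) (by omega)]
    obtain ⟨a, rfl⟩ := Submodule.mkQ_surjective _ a
    exact congrArg (upMk E).hom (funext fun h => H ((a : G → A) h) b c)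
  | pred i ih =>
    apply (δDown E l (l + 1) rfl).injective
    rw [← cup_δDown γ (p' := m + 1) rfl rfl hl (by omega),
      ← cup_δDown β (p' := -(i : ℤ)) (by omega) rfl hm (by omega),
      ← cup_δDown γ' (p' := -(i : ℤ)) (by omega) rfl hl' (by omega),
      ih β.down γ.down γ'.down (fun a b c => ?_)]
    exact Subtype.ext (funext fun h => H ((show G → A from a.1) h) b c)

end

/-! ### Dimension shifting for `Hom` modules -/

/-- The sequence `Hom(X, S)`. -/
def homSeq (X : Rep.{0} k G) (S : ShortComplex (Rep.{0} k G)) : ShortComplex (Rep.{0} k G) :=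
  ShortComplex.mk ((Rep.ihom X).map S.f) ((Rep.ihom X).map S.g)
    (repHom_ext fun φ => LinearMap.ext fun x => congr(($(S.zero)).hom ((show X →ₗ[k] S.X₁ from φ) x)))

/-- Composition with the maps of a splitting of `S` splits `Hom(X, S)`. -/
def LinearSplitting.homSeq (X : Rep.{0} k G) {S : ShortComplex (Rep.{0} k G)}
    (σ : LinearSplitting S) : LinearSplitting (homSeq X S) where
  s := LinearMap.llcomp k X S.X₃ S.X₂ σ.s
  t := LinearMap.llcomp k X S.X₂ S.X₁ σ.t
  t_f φ := LinearMap.ext fun x => σ.t_f ((show X →ₗ[k] S.X₁ from φ) x)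
  g_s φ := LinearMap.ext fun x => σ.g_s ((show X →ₗ[k] S.X₃ from φ) x)
  f_t φ := LinearMap.ext fun x => σ.f_t ((show X →ₗ[k] S.X₂ from φ) x)

/-- The isomorphism `Hom(X, Fun(G, A)) ≅ Fun(G, Hom(X, A))`. -/
def ihomFunRepIso (X A : Rep.{0} k G) :
    (Rep.ihom X).obj (funRep A) ≅ funRep ((Rep.ihom X).obj A) :=
  Rep.mkIso (ρ := Representation.linHom X.ρ (funRho A)) (σ := funRho ((Rep.ihom X).obj A)) <| .mk
    { toFun := fun (φ : X →ₗ[k] (G → A)) h => LinearMap.proj h ∘ₗ φ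
      map_add' := fun _ _ => rfl
      map_smul' := fun _ _ => rfl
      invFun := fun (F : G → (X →ₗ[k] A)) => LinearMap.pi F
      left_inv := fun _ => rfl
      right_inv := fun _ => rfl }
    fun _ => rfl

variable [Fintype G]

/-- `Hom(X, Fun(G, A))` is again induced, so its Tate cohomology vanishes. -/
lemma isZero_ihom_funRep (X A : Rep.{0} k G) (n : ℤ) :
    Limits.IsZero (tateCohomology ((Rep.ihom X).obj (funRep A)) n) :=
  (isZero_funRep _ n).of_iso ((tateCohomologyFunctor n).mapIso (ihomFunRepIso X A))

/-- The map `Ĥⁿ(G, Hom(X, A)) → Ĥⁿ(G, Hom(X, C))` induced by `f : A ⟶ C`. -/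
def homMap (n : ℤ) (X : Rep.{0} k G) {A C : Rep.{0} k G} (f : A ⟶ C) :
    TateHom n X A →+ TateHom n X C :=
  tateMap ((Rep.ihom X).map f) n

/-- The connecting homomorphism `Ĥⁱ(G, Hom(X, S₃)) → Ĥⁱ⁺¹(G, Hom(X, S₁))` of a split sequence. -/
def homδ (X : Rep.{0} k G) {S : ShortComplex (Rep.{0} k G)} (σ : LinearSplitting S) (i j : ℤ)
    (hij : i + 1 = j) : TateHom i X S.X₃ →+ TateHom j X S.X₁ :=
  tateδ (σ.homSeq X).shortExact i j hij

lemma homδ_bijective (X : Rep.{0} k G) {S : ShortComplex (Rep.{0} k G)} (σ : LinearSplitting S)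
    (hS : ∀ n, Limits.IsZero (tateCohomology ((Rep.ihom X).obj S.X₂) n)) (i j : ℤ)
    (hij : i + 1 = j) : Function.Bijective (homδ X σ i j hij) :=
  ((TateCohomology.map_tateComplexFunctor_shortExact (σ.homSeq X).shortExact).δIso i j hij
    (hS i) (hS j)).toLinearEquiv.bijective

lemma homMap_homδ (X : Rep.{0} k G) {S T : ShortComplex (Rep.{0} k G)} (σ : LinearSplitting S)
    (τ : LinearSplitting T) (φ : S ⟶ T) (i j : ℤ) (hij : i + 1 = j) (x : TateHom i X S.X₃) :
    homMap j X φ.τ₁ (homδ X σ i j hij x) = homδ X τ i j hij (homMap i X φ.τ₃ x) :=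
  tateMap_tateδ (σ.homSeq X).shortExact (τ.homSeq X).shortExact
    { τ₁ := (Rep.ihom X).map φ.τ₁
      τ₂ := (Rep.ihom X).map φ.τ₂
      τ₃ := (Rep.ihom X).map φ.τ₃
      comm₁₂ := repHom_ext fun ψ => LinearMap.ext fun x =>
        congr(($(φ.comm₁₂)).hom ((show X →ₗ[k] S.X₁ from ψ) x))
      comm₂₃ := repHom_ext fun ψ => LinearMap.ext fun x =>
        congr(($(φ.comm₂₃)).hom ((show X →ₗ[k] S.X₂ from ψ) x)) } i j hij x

lemma compCup_homδ {X' X : Rep.{0} k G} {S : ShortComplex (Rep.{0} k G)} (σ : LinearSplitting S)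
    {p p' q m m' : ℤ} (hpp : p + 1 = p') (hmm : m + 1 = m') (h : p + q = m) (h' : p' + q = m')
    (x : TateHom p X S.X₃) (y : TateHom q X' X) :
    compCup p' q m' h' (homδ X σ p p' hpp x) y = homδ X' σ m m' hmm (compCup p q m h x y) :=
  SplitPairing.cup_tateδ (σ := σ.homSeq X) (τ := σ.homSeq X')
    ⟨compPairing X' X S.X₁, compPairing X' X S.X₂, compPairing X' X S.X₃, fun _ _ => rfl,
      fun _ _ => rfl, fun _ _ => rfl⟩ hpp hmm h h' x y

lemma compCup_assoc {X₁ X₂ X₃ A : Rep.{0} k G} {p q r m n l : ℤ} (hm : p + q = m) (hn : q + r = n)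
    (hl : m + r = l) (hl' : p + n = l) (x : TateHom p X₃ A) (y : TateHom q X₂ X₃)
    (z : TateHom r X₁ X₂) :
    compCup m r l hl (compCup p q m hm x y) z = compCup p n l hl' x (compCup q r n hn y z) :=
  cup_assoc _ _ _ _ (fun _ _ _ => rfl) hm hn hl hl' x y z

lemma idClass_compCup_apply {X' X : Rep.{0} k G} {q : ℤ} (x : TateHom q X' X) :
    compCup 0 q q (zero_add q) (idClass X) x = x := by
  have hl : (compPairing X' X X).left (idInv X) = 𝟙 ((Rep.ihom X').obj X) :=
    repHom_ext fun f => LinearMap.id_comp (show X' →ₗ[k] X from f)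
  refine (zeroClass_cup (compPairing X' X X) q (idInv X) x).trans ?_
  rw [hl]
  exact tateMap_id_apply q x

/-! ### Encoding pairs -/

/-- Bijections `Ĥⁱ(G, Hom(X, A)) ≃ Ĥʲ(G, Hom(X', A))`, natural in `A`. -/
structure NaturalEquiv (X X' : Rep.{0} k G) (i j : ℤ) where
  equiv (A : Rep.{0} k G) : TateHom i X A ≃ TateHom j X' A
  naturality {A C : Rep.{0} k G} (f : A ⟶ C) (x : TateHom i X A) :
    equiv C (homMap i X f x) = homMap j X' f (equiv A x)

/-- The morphism of sequences `0 → A → Fun(G, A) → A⁺ → 0` induced by `f : A ⟶ C`. -/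
def upSeqMap {A C : Rep.{0} k G} (f : A ⟶ C) : upSeq A ⟶ upSeq C where
  τ₁ := f
  τ₂ := funMap f
  τ₃ := upMap f
  comm₁₂ := rfl
  comm₂₃ := rfl

/-- The morphism of sequences `0 → A⁻ → Fun(G, A) → A → 0` induced by `f : A ⟶ C`. -/
def downSeqMap {A C : Rep.{0} k G} (f : A ⟶ C) : downSeq A ⟶ downSeq C where
  τ₁ := downMap f
  τ₂ := funMap f
  τ₃ := f
  comm₁₂ := rfl
  comm₂₃ := funMap_comp_funSum f

/-- The connecting isomorphism `Ĥⁱ(G, Hom(X, A⁺)) ≃ Ĥⁱ⁺¹(G, Hom(X, A))`. -/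
def homδUp (X A : Rep.{0} k G) (i j : ℤ) (hij : i + 1 = j) : TateHom i X (upMod A) ≃ TateHom j X A :=
  Equiv.ofBijective _ (homδ_bijective X (upSplitting A) (isZero_ihom_funRep X A) i j hij)

/-- The connecting isomorphism `Ĥⁱ(G, Hom(X, A)) ≃ Ĥⁱ⁺¹(G, Hom(X, A⁻))`. -/
def homδDown (X A : Rep.{0} k G) (i j : ℤ) (hij : i + 1 = j) :
    TateHom i X A ≃ TateHom j X (downMod A) :=
  Equiv.ofBijective _ (homδ_bijective X (downSplitting A) (isZero_ihom_funRep X A) i j hij)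

lemma homMap_homδUp (X : Rep.{0} k G) {A C : Rep.{0} k G} (f : A ⟶ C) (i j : ℤ)
    (hij : i + 1 = j) (x : TateHom i X (upMod A)) :
    homMap j X f (homδUp X A i j hij x) = homδUp X C i j hij (homMap i X (upMap f) x) :=
  homMap_homδ X (upSplitting A) (upSplitting C) (upSeqMap f) i j hij x

lemma homMap_homδDown (X : Rep.{0} k G) {A C : Rep.{0} k G} (f : A ⟶ C) (i j : ℤ)
    (hij : i + 1 = j) (x : TateHom i X A) :
    homMap j X (downMap f) (homδDown X A i j hij x) = homδDown X C i j hij (homMap i X f x) :=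
  homMap_homδ X (downSplitting A) (downSplitting C) (downSeqMap f) i j hij x

lemma compCup_homδUp {X' X A : Rep.{0} k G} {p p' q m m' : ℤ} (hpp : p + 1 = p')
    (hmm : m + 1 = m') (h : p + q = m) (h' : p' + q = m') (x : TateHom p X (upMod A))
    (y : TateHom q X' X) :
    compCup p' q m' h' (homδUp X A p p' hpp x) y = homδUp X' A m m' hmm (compCup p q m h x y) :=
  compCup_homδ (upSplitting A) hpp hmm h h' x y

lemma compCup_homδDown {X' X A : Rep.{0} k G} {p p' q m m' : ℤ} (hpp : p + 1 = p')
    (hmm : m + 1 = m') (h : p + q = m) (h' : p' + q = m') (x : TateHom p X A)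
    (y : TateHom q X' X) :
    compCup p' q m' h' (homδDown X A p p' hpp x) y =
      homδDown X' A m m' hmm (compCup p q m h x y) :=
  compCup_homδ (downSplitting A) hpp hmm h h' x y

namespace NaturalEquiv

variable {X X' : Rep.{0} k G} {i j : ℤ}

/-- A natural equivalence in degrees `(i, j)` gives one in degrees `(i + 1, j + 1)`. -/
def succ (Φ : NaturalEquiv X X' i j) : NaturalEquiv X X' (i + 1) (j + 1) where
  equiv A := (homδUp X A i (i + 1) rfl).symm.trans
    ((Φ.equiv (upMod A)).trans (homδUp X' A j (j + 1) rfl))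
  naturality {A C} f x := by
    obtain ⟨x, rfl⟩ := (homδUp X A i (i + 1) rfl).surjective x
    simp only [Equiv.trans_apply, homMap_homδUp, Equiv.symm_apply_apply, Φ.naturality]

/-- A natural equivalence in degrees `(i + 1, j + 1)` gives one in degrees `(i, j)`. -/
def pred (Φ : NaturalEquiv X X' (i + 1) (j + 1)) : NaturalEquiv X X' i j where
  equiv A := (homδDown X A i (i + 1) rfl).trans
    ((Φ.equiv (downMod A)).trans (homδDown X' A j (j + 1) rfl).symm)
  naturality {A C} f x := by
    simp only [Equiv.trans_apply]
    rw [Equiv.symm_apply_eq, ← homMap_homδDown, ← homMap_homδDown, Φ.naturality,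
      Equiv.apply_symm_apply]

end NaturalEquiv

lemma IsEncodingPair.nonempty_naturalEquiv {r : ℤ} {X X' : Rep.{0} k G}
    (h : IsEncodingPair r X X') : Nonempty (NaturalEquiv X X' 0 r) := by
  obtain ⟨i, ⟨e⟩⟩ := h
  have Φ : NaturalEquiv X X' i (i + r) :=
    { equiv := fun A => (e.app A).toLinearEquiv.toEquiv
      naturality := fun f x => congr($(e.hom.naturality f) x) }
  -- the natural equivalence moves one degree at a time towards degree `0`
  have key : ∀ j l : ℤ, j + r = l → Nonempty (NaturalEquiv X X' j l) →
      Nonempty (NaturalEquiv X X' 0 r) := by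
    intro j
    induction j using Int.induction_on with
    | zero =>
      intro l hl hΦ
      obtain rfl : r = l := by omega
      exact hΦ
    | succ n ih =>
      rintro l hl ⟨Φ⟩
      obtain rfl : l = (n + r : ℤ) + 1 := by omega
      exact ih _ rfl ⟨Φ.pred⟩
    | pred n ih =>
      rintro l hl ⟨Φ⟩
      obtain rfl : l = (-n + r : ℤ) - 1 := by omega
      refine ih _ rfl ⟨?_⟩
      have := Φ.succ
      rwa [sub_add_cancel, sub_add_cancel] at this
  exact key i _ rfl ⟨Φ⟩

variable {X X' : Rep.{0} k G} {r : ℤ}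

/-- The Yoneda argument: a natural equivalence in degree `0` is the cup product with the image of
the identity. -/
lemma NaturalEquiv.eq_compCup (Φ : NaturalEquiv X X' 0 r) (A : Rep.{0} k G) (x : TateHom 0 X A) :
    Φ.equiv A x = compCup 0 r r (zero_add r) x (Φ.equiv X (idClass X)) := by
  obtain ⟨φ, rfl⟩ := homClass_surjective X A x
  let f : X ⟶ A := Rep.ofHom ⟨φ.1, fun g => LinearMap.ext fun x => by
    have h : A.ρ g ((show X →ₗ[k] A from φ.1) (X.ρ g⁻¹ (X.ρ g x))) =
        (show X →ₗ[k] A from φ.1) (X.ρ g x) := LinearMap.congr_fun (φ.2 g) (X.ρ g x)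
    refine h.symm.trans ?_
    rw [← Module.End.mul_apply, ← map_mul, inv_mul_cancel, map_one, Module.End.one_apply]
    rfl⟩
  have h1 : homMap 0 X f (idClass X) = homClass X A φ :=
    (tateMap_zeroClass _ _).trans rfl
  rw [← h1, Φ.naturality, h1]
  exact (zeroClass_cup (compPairing X' X A) r φ _).symm

/-- If `y ↦ y ∪ u` is bijective in degree zero for all modules, then it is in all degrees. -/
lemma compCup_bijective {u : TateHom r X' X}
    (hu : ∀ A, Function.Bijective fun y : TateHom 0 X A => compCup 0 r r (zero_add r) y u)
    (A : Rep.{0} k G) (i j : ℤ) (hij : i + r = j) :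
    Function.Bijective fun y : TateHom i X A => compCup i r j hij y u := by
  induction i using Int.induction_on generalizing A j with
  | zero =>
    obtain rfl : r = j := by omega
    exact hu A
  | succ n ih =>
    have h := ((homδUp X' A (j - 1) j (by omega)).bijective.comp
      (ih (upMod A) (j - 1) (by omega))).comp (homδUp X A n (n + 1) rfl).symm.bijective
    convert h using 2 with y
    obtain ⟨y, rfl⟩ := (homδUp X A n (n + 1) rfl).surjective y
    simp only [Function.comp_apply, Equiv.symm_apply_apply]
    exact compCup_homδUp rfl _ _ _ y u
  | pred n ih =>
    have h := ((homδDown X' A j (j + 1) rfl).symm.bijective.comp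
      (ih (downMod A) (j + 1) (by omega))).comp
        (homδDown X A (-n - 1) (-n) (by omega)).bijective
    convert h using 2 with y
    simp only [Function.comp_apply]
    rw [compCup_homδDown (m := j) _ rfl hij, Equiv.symm_apply_apply]

/-- An encoding pair comes with mutually inverse classes `u` and `v`, as an isomorphism in the
stable category up to a shift. -/
lemma IsEncodingPair.exists_unit (h : IsEncodingPair r X X') :
    ∃ (u : TateHom r X' X) (v : TateHom (-r) X X'),
      compCup r (-r) 0 (add_neg_cancel r) u v = idClass X ∧
      compCup (-r) r 0 (neg_add_cancel r) v u = idClass X' := by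
  obtain ⟨Φ⟩ := h.nonempty_naturalEquiv
  obtain ⟨u, hu⟩ : ∃ u, u = Φ.equiv X (idClass X) := ⟨_, rfl⟩
  have hu0 : ∀ A, Function.Bijective fun y : TateHom 0 X A => compCup 0 r r (zero_add r) y u := by
    intro A
    convert (Φ.equiv A).bijective using 2 with y
    rw [hu]
    exact (Φ.eq_compCup A y).symm
  obtain ⟨v, hv⟩ := (compCup_bijective hu0 X' (-r) 0 (neg_add_cancel r)).2 (idClass X')
  refine ⟨u, v, (hu0 X).1 ?_, hv⟩
  have hv : compCup (-r) r 0 (neg_add_cancel r) v u = idClass X' := hv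
  change compCup 0 r r (zero_add r) (compCup r (-r) 0 _ u v) u =
    compCup 0 r r (zero_add r) (idClass X) u
  -- `(u ∪ v) ∪ u = u ∪ (v ∪ u) = u = 1 ∪ u`
  rw [compCup_assoc (n := 0) _ (neg_add_cancel r) _ (add_zero r), hv, compCup_idClass, hu,
    ← Φ.eq_compCup]

/-- The homomorphism `y ↦ (x ↦ y ∪ x)`. -/
def cupHom (X X' A : Rep.{0} k G) (i r : ℤ) :
    TateHom i X A →+ (TateHom r X' X →ₗ[(TateEnd X')ᵐᵒᵖ] TateHom (i + r) X' A) where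
  toFun y :=
    { toFun := compCup i r (i + r) rfl y
      map_add' := map_add _
      map_smul' := fun ρ x => by
        obtain ⟨ρ, rfl⟩ := MulOpposite.op_surjective ρ
        rw [TateHom.op_smul_def, RingHom.id_apply, TateHom.op_smul_def, compCup_assoc] }
  map_zero' := LinearMap.ext fun x => congr($(map_zero (compCup i r (i + r) rfl)) x)
  map_add' y z := LinearMap.ext fun x => congr($(map_add (compCup i r (i + r) rfl) y z) x)

lemma IsEncodingPair.cupHom_bijective (h : IsEncodingPair r X X') (A : Rep.{0} k G) (i : ℤ) :
    Function.Bijective (cupHom X X' A i r) := by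
  obtain ⟨u, v, huv, hvu⟩ := h.exists_unit
  have hleft (y : TateHom i X A) :
      compCup (i + r) (-r) i (by omega) (compCup i r (i + r) rfl y u) v = y := by
    rw [compCup_assoc (n := 0) _ (add_neg_cancel r) _ (add_zero i), huv, compCup_idClass]
  have hright (w : TateHom (i + r) X' A) :
      compCup i r (i + r) rfl (compCup (i + r) (-r) i (by omega) w v) u = w := by
    rw [compCup_assoc (n := 0) _ (neg_add_cancel r) _ (add_zero _), hvu, compCup_idClass]
  -- `u` generates `Ĥ^r(G, Hom(X', X))` as a right module
  have hgen (x : TateHom r X' X) :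
      x = MulOpposite.op (show TateEnd X' from compCup (-r) r 0 (neg_add_cancel r) v x) • u := by
    rw [TateHom.op_smul_def, ← compCup_assoc (add_neg_cancel r) _ (zero_add r), huv,
      idClass_compCup_apply]
  constructor
  · intro y z hyz
    have h1 : compCup i r (i + r) rfl y u = compCup i r (i + r) rfl z u := congr($hyz u)
    rw [← hleft y, h1, hleft]
  · intro φ
    refine ⟨compCup (i + r) (-r) i (by omega) (φ u) v, LinearMap.ext fun x => ?_⟩
    rw [hgen x, map_smul, map_smul]
    exact congrArg _ (hright (φ u))

end

end TateCup

end

theorem theorem4p3 {G : Type} [Group G] [Fintype G] (r : ℤ) (X X' : Rep.{0} ℤ G)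
    (h : TateCup.IsEncodingPair r X X') (A : Rep.{0} ℤ G) (i : ℤ) :
    ∃ e : TateCup.TateHom i X A ≃+
        (TateCup.TateHom r X' X →ₗ[(TateCup.TateEnd X')ᵐᵒᵖ] TateCup.TateHom (i + r) X' A),
      ∀ (y : TateCup.TateHom i X A) (x : TateCup.TateHom r X' X),
        e y x = TateCup.compCup i r (i + r) rfl y x :=
  ⟨AddEquiv.ofBijective _ (h.cupHom_bijective A i), fun _ _ => rfl⟩
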